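/- Let $n\ge 2$. For each partition $p=(p_1\ge p_2\ge\dots)\vdash n$ fix an orthogonal matrix form $\rho_p:S_n\to O(d_p)$ of the irreducible representation of $S_n$ indexed by $p$ (the real representation afforded by the left ideal of $\mathbb{R}[S_n]$ generated by a Young symmetrizer of shape $p$), and let $\Phi_p$ be the family of the $d_p^2$ functions $\rho_p^{ij}:S_n\to\mathbb{R}$, $\rho_p^{ij}(\pi)=(\rho_p(\pi))_{ij}$. Let $X\subset S_n$ be closed under inverses and conjugation with $1\notin X$, and let $G=\mathrm{Cay}(S_n,X)$ be the corresponding normal Cayley graph. A nonempty set $\mathcal D\subseteq S_n$ is a design averaging a collection $\Phi$ of functions if $\frac1{|\mathcal D|}\sum_{\pi\in\mathcal D}\phi(\pi)=\frac1{n!}\sum_{\pi\in S_n}\phi(\pi)$ for all $\phi\in\Phi$; it is minimal if no proper subset of it is a design averaging $\Phi$. The $\Phi_p$-eigenpolytope of $G$ is the convex hull in $\mathbb{R}^{d_p\times d_p}$ of the $n!$ points $u_\pi=(\rho_p^{ij}(\pi))_{i,j}$, $\pi\in S_n$. Let $S_{n-1}\subset S_n$ be the subgroup of permutations fixing $n$.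 Then: 1. All functions in all the $\Phi_p$ are eigenvectors of the Laplacian of $G$. 2. The $\Phi_{(n-1,1)}$-eigenpolytope of $G$ is affinely isomorphic to the Birkhoff polytope, the convex hull of the permutation matrices in $\mathbb{R}^{n\times n}$: there is an affine map that maps the eigenpolytope bijectively onto the Birkhoff polytope and sends $u_\pi$ to the permutation matrix of $\pi$ (the matrix with entry $1$ at $(i,\pi(i))$ for all $i$) for every $\pi\in S_n$. 3. The minimal designs averaging all $\Phi_p$ with $p_1<n-1$ are exactly the cosets $\sigma S_{n-1}\tau$ ($\sigma,\tau\in S_n$), and these cosets are exactly the sets $\{\pi\in S_n:\pi(i)=j\}$ with $i,j\in\{1,\dots,n\}$. 4. Every design averaging all $\Phi_p$ with $p_1<n-1$ is a union of cosets $\sigma S_{n-1}\tau$. -/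

import Mathlib

open Equiv

noncomputable section

/-! ### Graphs: normal Cayley graphs, eigenvectors, designs, eigenpolytopes -/

/-- `X` is the connection set of an undirected loopless normal Cayley graph: it misses the identity
and is closed under inverses and under conjugation. -/
def IsNormalConnectionSet {Γ : Type*} [Group Γ] (X : Set Γ) : Prop :=
  1 ∉ X ∧ (∀ x ∈ X, x⁻¹ ∈ X) ∧ ∀ x ∈ X, ∀ g : Γ, g * x * g⁻¹ ∈ X

open Classical in
/-- `φ : V → ℝ` is an eigenvector (in particular nonzero) of the Laplacian of `G`. -/
def IsLaplacianEigenvector {V : Type*} [Fintype V] (G : SimpleGraph V) (φ : V → ℝ) : Prop :=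
  ∃ c : ℝ, Module.End.HasEigenvector (Matrix.toLin' (G.lapMatrix ℝ)) c φ

/-- The vertex set `D` averages `φ`: the mean of `φ` over `D` is its mean over `V`. -/
def Averages {V : Type*} [Fintype V] (D : Finset V) (φ : V → ℝ) : Prop :=
  (1 / (D.card : ℝ)) * ∑ v ∈ D, φ v = (1 / (Fintype.card V : ℝ)) * ∑ v, φ v

/-- A `Φ`-design is a nonempty vertex set that averages every member of `Φ`. -/
def IsDesign {V : Type*} [Fintype V] (Φ : Set (V → ℝ)) (D : Finset V) : Prop :=
  D.Nonempty ∧ ∀ φ ∈ Φ, Averages D φ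

/-- The column indexed by the vertex `v` of the matrix whose rows are the functions `φ i`. -/
def eigenColumn {ι V : Type*} (φ : ι → V → ℝ) (v : V) : ι → ℝ := fun i => φ i v

/-- The eigenpolytope of a family of eigenvectors: the convex hull of the columns of the matrix
whose rows are the members of the family. -/
def eigenpolytope {ι V : Type*} (φ : ι → V → ℝ) : Set (ι → ℝ) :=
  convexHull ℝ (Set.range (eigenColumn φ))

/-- The Birkhoff polytope: the convex hull of the `n × n` permutation matrices. -/
def birkhoffPolytope (n : ℕ) : Set (Matrix (Fin n) (Fin n) ℝ) :=
  convexHull ℝ (Set.range fun π : Perm (Fin n) => π.permMatrix ℝ)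

/-! ### Partitions, Young symmetrizers, Specht modules -/

/-- The first (largest) part of a partition. -/
def firstPart {n : ℕ} (p : n.Partition) : ℕ := p.parts.sup

/-- The partition `(n - 1, 1)` of `n`. -/
def standardPartition (n : ℕ) (hn : 2 ≤ n) : n.Partition where
  parts := {n - 1, 1}
  parts_pos := by
    intro i hi
    simp only [Multiset.insert_eq_cons, Multiset.mem_cons, Multiset.mem_singleton] at hi
    omega
  parts_sum := by
    simp only [Multiset.insert_eq_cons, Multiset.sum_cons, Multiset.sum_singleton]
    omega

/-- The Young diagram of a partition: row `i` has as many cells as the `i`-th largest part. -/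
def partitionDiagram {n : ℕ} (p : n.Partition) : YoungDiagram :=
  YoungDiagram.ofRowLens (p.parts.sort (· ≥ ·)) (p.parts.pairwise_sort (· ≥ ·)).sortedGE

/-- A tableau of shape `p`: a bijective placement of the entries `Fin n` in the cells of the
diagram, given by the cell (row, column) of each entry. -/
abbrev Tableau {n : ℕ} (p : n.Partition) : Type :=
  Fin n ≃ {c : ℕ × ℕ // c ∈ (partitionDiagram p).cells}

/-- The group algebra `ℝ[S_n]`. -/
abbrev SymAlgebra (n : ℕ) : Type := MonoidAlgebra ℝ (Perm (Fin n))

open Classical in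
/-- The row sum `∑ σ` over all permutations `σ` that preserve each row of the tableau. -/
def rowSum {n : ℕ} {p : n.Partition} (T : Tableau p) : SymAlgebra n :=
  ∑ σ : Perm (Fin n) with ∀ k, (T (σ k)).1.1 = (T k).1.1, MonoidAlgebra.single σ 1

open Classical in
/-- The signed column sum `∑ sgn(σ) σ` over all permutations `σ` that preserve each column of the
tableau. -/
def columnSum {n : ℕ} {p : n.Partition} (T : Tableau p) : SymAlgebra n :=
  ∑ σ : Perm (Fin n) with ∀ k, (T (σ k)).1.2 = (T k).1.2,
    MonoidAlgebra.single σ (((Perm.sign σ : ℤˣ) : ℤ) : ℝ)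

/-- The Young symmetrizer of a tableau. -/
def youngSymmetrizer {n : ℕ} {p : n.Partition} (T : Tableau p) : SymAlgebra n :=
  rowSum T * columnSum T

/-- The Specht module of a tableau: the left ideal of `ℝ[S_n]` generated by its Young symmetrizer.
This is the irreducible representation of `S_n` indexed by the shape of the tableau. -/
def spechtModule {n : ℕ} {p : n.Partition} (T : Tableau p) : Ideal (SymAlgebra n) :=
  Ideal.span {youngSymmetrizer T}

/-- The orthogonal matrix representation `ρ` of `S_n` is a matrix form of the irreducible
representation indexed by the partition `p`. -/
def IsOrthogonalForm {n d : ℕ} (p : n.Partition)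
    (ρ : Perm (Fin n) →* Matrix.orthogonalGroup (Fin d) ℝ) : Prop :=
  ∃ (T : Tableau p) (e : spechtModule T ≃ₗ[ℝ] (Fin d → ℝ)),
    ∀ (σ : Perm (Fin n)) (x : spechtModule T),
      e (MonoidAlgebra.single σ (1 : ℝ) • x) =
        Matrix.mulVec (ρ σ : Matrix (Fin d) (Fin d) ℝ) (e x)

/-- The family `Φ_p` of the `d²` matrix entries `π ↦ ρ(π)_{i,j}` of a matrix representation. -/
def matrixEntries {n d : ℕ} (ρ : Perm (Fin n) →* Matrix.orthogonalGroup (Fin d) ℝ)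
    (ij : Fin d × Fin d) (π : Perm (Fin n)) : ℝ :=
  (ρ π : Matrix (Fin d) (Fin d) ℝ) ij.1 ij.2

/-- The union of the `Φ_p` over all partitions `p` of `n` with first part smaller than `m`. -/
def entriesBelow {n : ℕ} {d : n.Partition → ℕ}
    (ρ : ∀ p : n.Partition, Perm (Fin n) →* Matrix.orthogonalGroup (Fin (d p)) ℝ) (m : ℕ) :
    Set (Perm (Fin n) → ℝ) :=
  ⋃ (p : n.Partition) (_ : firstPart p < m), Set.range (matrixEntries (ρ p))

/-- The subgroup `S_t` of `S_n`: the permutations that fix every point except possibly the first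
`t` ones. -/
def symSubgroup (n t : ℕ) : Subgroup (Perm (Fin n)) :=
  fixingSubgroup (Perm (Fin n)) {k : Fin n | t ≤ (k : ℕ)}

/-- `D` is a (two-sided) coset `σ H τ` of the subgroup `H`. -/
def IsCosetOf {Γ : Type*} [Group Γ] (H : Subgroup Γ) (D : Finset Γ) : Prop :=
  ∃ σ τ : Γ, (D : Set Γ) = (fun s => σ * s * τ) '' (H : Set Γ)

end

/-! Write c_p for a Young symmetrizer of shape p. In `ℝ[S_n]`, with the adjoint g ↦ g⁻¹ and the
positive definite trace "coefficient at 1", the c_p are mutually orthogonal: c_p* x c_q = 0 for p ≠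
q. Averaging c_p c_p* over conjugates gives independent central elements, as many as there are
partitions, hence a basis of the center. So central elements act as scalars on each Specht module,
and an element annihilating all Specht modules is 0 (`exists_center_mul_eq_smul`,
`eq_zero_of_forall_kills`). The first fact, applied to the sum of X, gives the eigenvectors; matrix
entries are nonzero by `matrixEntries_ne_zero`.

For the rest, the span W of the indicators of the sets {π | π i = j} is compared with the matrix
entries. These indicators annihilate the modules with p_1 < n - 1 (`kills_pointCoset`), and elements
orthogonal to W annihilate those with p_1 ≥ n - 1 (`Perp.kills`). Hence W consists of exactly the
functions annihilating every module with p_1 < n - 1. The indicator of a design D lies in W, so it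
is linear in the permutation matrix. Birkhoff's theorem then shows that each π in D lies in some {σ
| σ i = π i} contained in D (`exists_forall_apply_eq_mem`), whence minimal designs and unions.
Duality with W also makes the entries of type (n - 1, 1) and the permutation matrix affine functions
of each other. -/

open Equiv

noncomputable section

/-! ### The group algebra of a finite group -/

namespace GroupAlgebra

variable {G : Type*} [Group G] [Fintype G]

/-- The adjoint `∑ x_g g ↦ ∑ x_g g⁻¹`. -/
def adj (x : MonoidAlgebra ℝ G) : MonoidAlgebra ℝ G :=
  ∑ g, MonoidAlgebra.single g⁻¹ (x.coeff g)

lemma coeff_adj (x : MonoidAlgebra ℝ G) (h : G) : (adj x).coeff h = x.coeff h⁻¹ := by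
  classical
  simp only [adj, MonoidAlgebra.coeff_sum, MonoidAlgebra.coeff_single, Finsupp.coe_finsetSum,
    Finset.sum_apply, Finsupp.single_apply, inv_eq_iff_eq_inv]
  simp

lemma coeff_mul_eq_sum (x y : MonoidAlgebra ℝ G) (h : G) :
    (x * y).coeff h = ∑ g, x.coeff g * y.coeff (g⁻¹ * h) := by
  rw [MonoidAlgebra.coeff_mul_apply_left, Finsupp.sum_fintype]
  simp

lemma eq_sum_single {H : Type*} [Fintype H] (x : MonoidAlgebra ℝ H) :
    x = ∑ g, MonoidAlgebra.single g (x.coeff g) := by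
  classical
  ext h
  simp [MonoidAlgebra.coeff_sum]

lemma eq_sum_smul_single (x : MonoidAlgebra ℝ G) :
    x = ∑ g, x.coeff g • MonoidAlgebra.single g (1 : ℝ) := by
  simpa using eq_sum_single x

lemma coeff_one_mul_comm (x y : MonoidAlgebra ℝ G) : (x * y).coeff 1 = (y * x).coeff 1 := by
  simp only [coeff_mul_eq_sum, mul_one]
  rw [← Equiv.sum_comp (Equiv.inv G)]
  simp [mul_comm]

lemma adj_single (g : G) (r : ℝ) :
    adj (MonoidAlgebra.single g r) = MonoidAlgebra.single g⁻¹ r := by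
  classical
  ext h
  simp only [coeff_adj, MonoidAlgebra.coeff_single, Finsupp.single_apply]
  congr 1
  simp [inv_eq_iff_eq_inv]

@[simp] lemma adj_adj (x : MonoidAlgebra ℝ G) : adj (adj x) = x := by
  ext h; simp [coeff_adj]

@[simp] lemma adj_mul (x y : MonoidAlgebra ℝ G) : adj (x * y) = adj y * adj x := by
  ext h
  simp only [coeff_adj, coeff_mul_eq_sum]
  rw [← Equiv.sum_comp (Equiv.mulLeft h⁻¹)]
  simp [mul_comm]

lemma coeff_mul_adj_self (x : MonoidAlgebra ℝ G) : (x * adj x).coeff 1 = ∑ g, x.coeff g ^ 2 := by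
  simp [coeff_mul_eq_sum, coeff_adj, sq]

lemma coeff_mul_adj_self_nonneg (x : MonoidAlgebra ℝ G) : 0 ≤ (x * adj x).coeff 1 := by
  rw [coeff_mul_adj_self]; positivity

lemma coeff_mul_adj_self_pos {x : MonoidAlgebra ℝ G} (hx : x ≠ 0) : 0 < (x * adj x).coeff 1 := by
  refine lt_of_le_of_ne (coeff_mul_adj_self_nonneg x) fun h => hx ?_
  rw [coeff_mul_adj_self, eq_comm, Finset.sum_eq_zero_iff_of_nonneg fun _ _ => sq_nonneg _] at h
  ext g
  simpa using h g (Finset.mem_univ g)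

/-- Its trace is the sum of the squared coefficients of x. This positivity does the work of
semisimplicity throughout. -/
lemma adj_mul_self_ne_zero {x : MonoidAlgebra ℝ G} (hx : x ≠ 0) : adj x * x ≠ 0 := fun h => by
  have := coeff_mul_adj_self_pos hx
  rw [coeff_one_mul_comm, h] at this
  simp at this

/-- The sum of all conjugates of `w`. -/
def conjSum (w : MonoidAlgebra ℝ G) : MonoidAlgebra ℝ G :=
  ∑ g : G, MonoidAlgebra.single g 1 * w * MonoidAlgebra.single g⁻¹ 1

lemma mem_center_of_comm_single {z : MonoidAlgebra ℝ G}
    (h : ∀ g, MonoidAlgebra.single g 1 * z = z * MonoidAlgebra.single g 1) :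
    z ∈ Subalgebra.center ℝ (MonoidAlgebra ℝ G) := by
  rw [Subalgebra.mem_center_iff]
  intro x
  rw [eq_sum_smul_single x]
  simp only [Finset.sum_mul, Finset.mul_sum, smul_mul_assoc, mul_smul_comm, h]

lemma conjSum_mem_center (w : MonoidAlgebra ℝ G) :
    conjSum w ∈ Subalgebra.center ℝ (MonoidAlgebra ℝ G) := by
  refine mem_center_of_comm_single fun h => ?_
  rw [conjSum, Finset.mul_sum, Finset.sum_mul, ← Equiv.sum_comp (Equiv.mulLeft h⁻¹)]
  refine Finset.sum_congr rfl fun g _ => ?_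
  simp only [Equiv.coe_mulLeft, mul_inv_rev, inv_inv]
  rw [← mul_assoc, ← mul_assoc, MonoidAlgebra.single_mul_single, mul_inv_cancel_left, mul_one,
    mul_assoc _ (MonoidAlgebra.single g⁻¹ 1), MonoidAlgebra.single_mul_single, mul_one]

lemma coeff_one_conjSum (w : MonoidAlgebra ℝ G) :
    (conjSum w).coeff 1 = Fintype.card G * w.coeff 1 := by
  have h (g : G) : (MonoidAlgebra.single g (1 : ℝ) * w * MonoidAlgebra.single g⁻¹ 1).coeff 1
      = w.coeff 1 := by
    rw [coeff_one_mul_comm, ← mul_assoc, MonoidAlgebra.single_mul_single, inv_mul_cancel, mul_one,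
      ← MonoidAlgebra.one_def, one_mul]
  simp [conjSum, MonoidAlgebra.coeff_sum, h]

/-- `b` annihilates the left ideal generated by `c`. -/
def Kills (b c : MonoidAlgebra ℝ G) : Prop := ∀ x, b * x * c = 0

lemma Kills.mul_left {b c : MonoidAlgebra ℝ G} (h : Kills b c) (y : MonoidAlgebra ℝ G) :
    Kills (y * b) c := fun x => by rw [mul_assoc y, mul_assoc y, h x, mul_zero]

lemma Kills.mul_right {b c : MonoidAlgebra ℝ G} (h : Kills b c) (y : MonoidAlgebra ℝ G) :
    Kills (b * y) c := fun x => by rw [mul_assoc b, h]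

lemma Kills.conjSum {b c : MonoidAlgebra ℝ G} (h : Kills b c) : Kills (conjSum b) c := fun x => by
  rw [GroupAlgebra.conjSum, Finset.sum_mul, Finset.sum_mul]
  exact Finset.sum_eq_zero fun g _ => ((h.mul_left _).mul_right _) x

lemma kills_of_forall_single {b c : MonoidAlgebra ℝ G}
    (h : ∀ g, b * MonoidAlgebra.single g 1 * c = 0) : Kills b c := fun x => by
  rw [eq_sum_smul_single x]
  simp only [Finset.mul_sum, Finset.sum_mul, mul_smul_comm, smul_mul_assoc, h, smul_zero,
    Finset.sum_const_zero]

/-- After multiplication by `adj c`, the trace is the sum over g of the squared norms of c* g c; the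
term g = 1 is positive. -/
lemma conjSum_mul_adj_mul_ne_zero {c : MonoidAlgebra ℝ G} (hc : c ≠ 0) :
    conjSum (c * adj c) * c ≠ 0 := fun h => by
  have key : (conjSum (c * adj c) * c * adj c).coeff 1 = ∑ g : G,
      ((adj c * MonoidAlgebra.single g 1 * c) *
        adj (adj c * MonoidAlgebra.single g 1 * c)).coeff 1 := by
    simp only [conjSum, Finset.sum_mul, MonoidAlgebra.coeff_sum, Finsupp.coe_finsetSum,
      Finset.sum_apply]
    refine Finset.sum_congr rfl fun g _ => ?_
    rw [coeff_one_mul_comm]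
    simp only [adj_mul, adj_adj, adj_single, mul_assoc]
  rw [h, zero_mul, MonoidAlgebra.coeff_zero, Finsupp.zero_apply, eq_comm,
    Finset.sum_eq_zero_iff_of_nonneg fun _ _ => coeff_mul_adj_self_nonneg _] at key
  have h1 := key 1 (Finset.mem_univ 1)
  rw [← MonoidAlgebra.one_def, mul_one] at h1
  exact (coeff_mul_adj_self_pos (adj_mul_self_ne_zero hc)).ne' h1

/-! ### Completeness of a large enough orthogonal family of left ideals -/

section Completeness

variable {ι : Type*} [Fintype ι] {c : ι → MonoidAlgebra ℝ G}

lemma conjSum_mul_eq_zero (horth : ∀ i j, i ≠ j → Kills (adj (c i)) (c j)) {i j : ι}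
    (hij : i ≠ j) : Kills (conjSum (c i * adj (c i))) (c j) :=
  ((horth i j hij).mul_left (c i)).conjSum

/-- If the central elements attached to `c` are orthogonal and numerous enough, they span the
center. -/
lemma exists_center_eq_sum (hc : ∀ i, c i ≠ 0) (horth : ∀ i j, i ≠ j → Kills (adj (c i)) (c j))
    (hcard : Module.finrank ℝ (Subalgebra.center ℝ (MonoidAlgebra ℝ G)) ≤ Fintype.card ι)
    {z : MonoidAlgebra ℝ G} (hz : z ∈ Subalgebra.center ℝ (MonoidAlgebra ℝ G)) :
    ∃ α : ι → ℝ, z = ∑ i, α i • conjSum (c i * adj (c i)) := by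
  classical
  have : FiniteDimensional ℝ (MonoidAlgebra ℝ G) :=
    Module.Finite.equiv (MonoidAlgebra.coeffLinearEquiv ℝ (S := ℝ) (M := G)).symm
  let v : ι → Subalgebra.center ℝ (MonoidAlgebra ℝ G) := fun i =>
    ⟨_, conjSum_mem_center (c i * adj (c i))⟩
  have hv : LinearIndependent ℝ v := by
    rw [Fintype.linearIndependent_iff]
    intro α hα j
    have h1 : ∑ i, α i • conjSum (c i * adj (c i)) = 0 := by
      simpa [v] using congrArg Subtype.val hα
    -- Multiplication by `c j` isolates the j-th coefficient.
    have h2 := congrArg (· * 1 * c j) h1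
    simp only [Finset.sum_mul, smul_mul_assoc, zero_mul] at h2
    rw [Finset.sum_eq_single j (fun i _ hi => by
      rw [conjSum_mul_eq_zero horth hi, smul_zero]) (by simp), mul_one] at h2
    exact (smul_eq_zero.1 h2).resolve_right (conjSum_mul_adj_mul_ne_zero (hc j))
  have htop := hv.span_eq_top_of_card_eq_finrank'
    (le_antisymm hv.fintype_card_le_finrank hcard)
  have hmem : (⟨z, hz⟩ : Subalgebra.center ℝ (MonoidAlgebra ℝ G)) ∈
      Submodule.span ℝ (Set.range v) := htop ▸ Submodule.mem_top
  obtain ⟨α, hα⟩ := (Submodule.mem_span_range_iff_exists_fun ℝ).1 hmem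
  exact ⟨α, by simpa [v] using (congrArg Subtype.val hα).symm⟩

lemma sum_conjSum_mul (horth : ∀ i j, i ≠ j → Kills (adj (c i)) (c j)) (α : ι → ℝ) (j : ι)
    (x : MonoidAlgebra ℝ G) : (∑ i, α i • conjSum (c i * adj (c i))) * x * c j =
      α j • (conjSum (c j * adj (c j)) * x * c j) := by
  classical
  simp only [Finset.sum_mul, smul_mul_assoc]
  exact Finset.sum_eq_single j (fun i _ hi => by
    rw [conjSum_mul_eq_zero horth hi, smul_zero]) (by simp)

/-- Central elements act as scalars on each of the left ideals. -/
theorem exists_center_mul_eq_smul (hc : ∀ i, c i ≠ 0)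
    (horth : ∀ i j, i ≠ j → Kills (adj (c i)) (c j))
    (hcard : Module.finrank ℝ (Subalgebra.center ℝ (MonoidAlgebra ℝ G)) ≤ Fintype.card ι)
    {z : MonoidAlgebra ℝ G} (hz : z ∈ Subalgebra.center ℝ (MonoidAlgebra ℝ G)) (j : ι) :
    ∃ s : ℝ, ∀ x, z * x * c j = s • (x * c j) := by
  obtain ⟨α, hα⟩ := exists_center_eq_sum hc horth hcard (one_mem (Subalgebra.center ℝ _))
  obtain ⟨β, rfl⟩ := exists_center_eq_sum hc horth hcard hz
  have h1 (x : MonoidAlgebra ℝ G) : x * c j = α j • (conjSum (c j * adj (c j)) * x * c j) := by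
    rw [← sum_conjSum_mul horth, ← hα, one_mul]
  -- Since 1 = ∑ α_i z_i, the element α_j z_j acts as the identity on the j-th ideal; this yields
  -- the scalar β_j / α_j.
  have hαj : α j ≠ 0 := fun h => hc j (by simpa [h] using h1 1)
  refine ⟨β j / α j, fun x => ?_⟩
  rw [sum_conjSum_mul horth, h1 x, smul_smul, div_mul_cancel₀ _ hαj]

/-- An element that annihilates all the left ideals is zero. -/
theorem eq_zero_of_forall_kills (hc : ∀ i, c i ≠ 0)
    (horth : ∀ i j, i ≠ j → Kills (adj (c i)) (c j))
    (hcard : Module.finrank ℝ (Subalgebra.center ℝ (MonoidAlgebra ℝ G)) ≤ Fintype.card ι)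
    {x : MonoidAlgebra ℝ G} (hx : ∀ i, Kills x (c i)) : x = 0 := by
  by_contra hne
  -- This central element also annihilates every ideal, so it is 0, although its trace is |G| times
  -- the squared norm of x.
  obtain ⟨α, hα⟩ := exists_center_eq_sum hc horth hcard (conjSum_mem_center (x * adj x))
  have hzero (j : ι) : α j = 0 := by
    have h := ((hx j).mul_right (adj x)).conjSum 1
    rw [hα, sum_conjSum_mul horth, mul_one] at h
    exact (smul_eq_zero.1 h).resolve_right (conjSum_mul_adj_mul_ne_zero (hc j))
  have h0 : conjSum (x * adj x) = 0 := by rw [hα]; simp [hzero]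
  have h1 := coeff_one_conjSum (x * adj x)
  rw [h0, MonoidAlgebra.coeff_zero, Finsupp.zero_apply, eq_comm, mul_eq_zero] at h1
  rcases h1 with h1 | h1
  · exact Fintype.card_ne_zero (by exact_mod_cast h1)
  · exact (coeff_mul_adj_self_pos hne).ne' h1

end Completeness

end GroupAlgebra

/-! ### Pairs of tableaux -/

namespace YoungDiagram

variable {n : ℕ} {μ ν : YoungDiagram}

lemma card_filter_row_lt (S : Fin n ≃ {c : ℕ × ℕ // c ∈ μ.cells}) (k : ℕ) :
    (Finset.univ.filter fun x => (S x).1.1 < k).card = (μ.cells.filter fun c => c.1 < k).card := by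
  refine Finset.card_nbij (fun x => (S x).1) ?_ ?_ ?_
  · intro x hx
    simpa using hx
  · intro x _ y _ h
    exact S.injective (Subtype.ext h)
  · intro c hc
    have hc' := Finset.mem_filter.1 (Finset.mem_coe.1 hc)
    exact ⟨S.symm ⟨c, hc'.1⟩, by simpa using hc'.2, by simp⟩

lemma card_filter_row_lt_col_eq (S : Fin n ≃ {c : ℕ × ℕ // c ∈ μ.cells}) (k j : ℕ) :
    (Finset.univ.filter fun x => (S x).1.1 < k ∧ (S x).1.2 = j).card = min k (μ.colLen j) := by
  conv_rhs => rw [← Finset.card_range (min k (μ.colLen j))]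
  refine Finset.card_nbij (fun x => (S x).1.1) ?_ ?_ ?_
  · intro x hx
    have hx' := (Finset.mem_filter.1 (Finset.mem_coe.1 hx)).2
    have h1 : ((S x).1.1, (S x).1.2) ∈ μ := (S x).2
    rw [mem_iff_lt_colLen, hx'.2] at h1
    simpa using ⟨hx'.1, h1⟩
  · intro x hx y hy h
    have hx' := (Finset.mem_filter.1 (Finset.mem_coe.1 hx)).2
    have hy' := (Finset.mem_filter.1 (Finset.mem_coe.1 hy)).2
    exact S.injective (Subtype.ext (Prod.ext h (hx'.2.trans hy'.2.symm)))
  · intro i hi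
    have hi' : i < k ∧ i < μ.colLen j := by simpa using hi
    exact ⟨S.symm ⟨(i, j), mem_iff_lt_colLen.2 hi'.2⟩, by simpa using hi'.1, by simp⟩

variable (S : Fin n ≃ {c : ℕ × ℕ // c ∈ μ.cells}) (S' : Fin n ≃ {c : ℕ × ℕ // c ∈ ν.cells})

/-- A column of `S'` meets each row of `S` at most once, so it has at most k entries from the first
k rows, and at most its own length. `S'` itself attains the minimum of the two bounds. -/
lemma card_filter_row_lt_col_eq_le
    (h : ∀ x y, (S x).1.1 = (S y).1.1 → (S' x).1.2 = (S' y).1.2 → x = y) (k j : ℕ) :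
    (Finset.univ.filter fun x => (S x).1.1 < k ∧ (S' x).1.2 = j).card ≤
      (Finset.univ.filter fun x => (S' x).1.1 < k ∧ (S' x).1.2 = j).card := by
  rw [card_filter_row_lt_col_eq]
  refine le_min ?_ ?_
  · conv_rhs => rw [← Finset.card_range k]
    refine Finset.card_le_card_of_injOn (fun x => (S x).1.1) ?_ ?_
    · intro x hx
      simpa using (Finset.mem_filter.1 (Finset.mem_coe.1 hx)).2.1
    · intro x hx y hy hxy
      have hx' := (Finset.mem_filter.1 (Finset.mem_coe.1 hx)).2
      have hy' := (Finset.mem_filter.1 (Finset.mem_coe.1 hy)).2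
      exact h x y hxy (hx'.2.trans hy'.2.symm)
  · refine le_trans (Finset.card_le_card ?_)
      ((card_filter_row_lt_col_eq S' (ν.colLen j) j).trans_le (min_le_left _ _))
    intro x hx
    have hx' := (Finset.mem_filter.1 hx).2
    have h1 : ((S' x).1.1, (S' x).1.2) ∈ ν := (S' x).2
    rw [mem_iff_lt_colLen, hx'.2] at h1
    simpa using ⟨h1, hx'.2⟩

lemma card_filter_eq_sum_col (P : Fin n → Prop) [DecidablePred P] :
    (Finset.univ.filter P).card = ∑ j ∈ Finset.univ.image (fun x => (S' x).1.2),
      (Finset.univ.filter fun x => P x ∧ (S' x).1.2 = j).card := by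
  rw [Finset.card_eq_sum_card_fiberwise (f := fun x => (S' x).1.2)
    (t := Finset.univ.image (fun x => (S' x).1.2)) (by intro x _; simp)]
  simp only [Finset.filter_filter]

/-- If entries in the same row of `S` lie in distinct columns of `S'`, then the shape of `S'`
dominates the shape of `S`. -/
lemma card_filter_row_lt_le
    (h : ∀ x y, (S x).1.1 = (S y).1.1 → (S' x).1.2 = (S' y).1.2 → x = y) (k : ℕ) :
    (μ.cells.filter fun c => c.1 < k).card ≤ (ν.cells.filter fun c => c.1 < k).card := by
  rw [← card_filter_row_lt S, ← card_filter_row_lt S', card_filter_eq_sum_col S',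
    card_filter_eq_sum_col S' fun x => (S' x).1.1 < k]
  exact Finset.sum_le_sum fun j _ => card_filter_row_lt_col_eq_le S S' h k j

/-- For equal shapes the columnwise inequalities have equal totals, so each is an equality. With k
the length of column j, all of that column of `S'` lies in the first k rows of `S`. -/
lemma mk_row_col_mem (S S' : Fin n ≃ {c : ℕ × ℕ // c ∈ μ.cells})
    (h : ∀ x y, (S x).1.1 = (S y).1.1 → (S' x).1.2 = (S' y).1.2 → x = y) (x : Fin n) :
    ((S x).1.1, (S' x).1.2) ∈ μ := by
  set j := (S' x).1.2 with hj
  set k := μ.colLen j with hk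
  have htot : ∑ j ∈ Finset.univ.image (fun x => (S' x).1.2),
      (Finset.univ.filter fun x => (S x).1.1 < k ∧ (S' x).1.2 = j).card =
      ∑ j ∈ Finset.univ.image (fun x => (S' x).1.2),
      (Finset.univ.filter fun x => (S' x).1.1 < k ∧ (S' x).1.2 = j).card := by
    rw [← card_filter_eq_sum_col, ← card_filter_eq_sum_col S' fun x => (S' x).1.1 < k,
      card_filter_row_lt, card_filter_row_lt]
  have heq := (Finset.sum_eq_sum_iff_of_le
    fun j _ => card_filter_row_lt_col_eq_le S S' h k j).1 htot j (by simp [hj])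
  have hcol : (Finset.univ.filter fun y => (S' y).1.1 < k ∧ (S' y).1.2 = j) =
      Finset.univ.filter fun y => (S' y).1.2 = j := by
    ext y
    simp only [Finset.mem_filter, Finset.mem_univ, true_and, and_iff_right_iff_imp]
    intro hy
    have h1 : ((S' y).1.1, (S' y).1.2) ∈ μ := (S' y).2
    rwa [mem_iff_lt_colLen, hy] at h1
  rw [hcol] at heq
  have hsub := Finset.eq_of_subset_of_card_le
    (s := Finset.univ.filter fun y => (S y).1.1 < k ∧ (S' y).1.2 = j)
    (t := Finset.univ.filter fun y => (S' y).1.2 = j)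
    (by intro y hy; simpa using (Finset.mem_filter.1 hy).2.2) heq.ge
  have hx : x ∈ Finset.univ.filter fun y => (S' y).1.2 = j := by simp [hj]
  rw [← hsub] at hx
  exact mem_iff_lt_colLen.2 (Finset.mem_filter.1 hx).2.1

lemma eq_of_card_filter_row_lt_eq
    (h : ∀ k, (μ.cells.filter fun c => c.1 < k).card = (ν.cells.filter fun c => c.1 < k).card) :
    μ = ν := by
  have key (κ : YoungDiagram) (i : ℕ) : (κ.cells.filter fun c => c.1 < i + 1).card =
      (κ.cells.filter fun c => c.1 < i).card + κ.rowLen i := by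
    rw [rowLen_eq_card, ← Finset.card_union_of_disjoint]
    · congr 1
      ext c
      simp only [Finset.mem_filter, Finset.mem_union, mem_row_iff, mem_cells, ← and_or_left,
        Nat.lt_succ_iff_lt_or_eq]
    · rw [Finset.disjoint_left]
      intro c hc hc'
      have h1 := (Finset.mem_filter.1 hc).2
      have h2 := (mem_row_iff.1 hc').2
      omega
  have hrow (i : ℕ) : μ.rowLen i = ν.rowLen i := by
    have h1 := key μ i
    have h2 := key ν i
    have h3 := h i
    have h4 := h (i + 1)
    omega
  ext ⟨i, j⟩
  rw [mem_cells, mem_cells, mem_iff_lt_rowLen, mem_iff_lt_rowLen, hrow]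

end YoungDiagram

/-! ### Partitions, their diagrams and their first parts -/

section Partition

variable {n : ℕ}

lemma partitionDiagram_injective : Function.Injective (partitionDiagram (n := n)) := by
  intro p q h
  have key (r : n.Partition) : (partitionDiagram r).rowLens = r.parts.sort (· ≥ ·) :=
    YoungDiagram.rowLens_ofRowLens_eq_self fun x hx =>
      r.parts_pos ((Multiset.mem_sort _).1 hx)
  have h1 : p.parts.sort (· ≥ ·) = q.parts.sort (· ≥ ·) := by rw [← key p, ← key q, h]
  ext1
  rw [← Multiset.sort_eq p.parts (· ≥ ·), h1, Multiset.sort_eq]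

lemma snd_lt_firstPart {p : n.Partition} {c : ℕ × ℕ} (hc : c ∈ partitionDiagram p) :
    c.2 < firstPart p := by
  obtain ⟨h1, h2⟩ := YoungDiagram.mem_ofRowLens.1 hc
  exact h2.trans_le (Multiset.le_sup ((Multiset.mem_sort _).1 (List.getElem_mem h1)))

lemma firstPart_mem_parts (p : n.Partition) (hn : n ≠ 0) : firstPart p ∈ p.parts := by
  have key (s : Multiset ℕ) : s ≠ 0 → s.sup ∈ s := by
    induction s using Multiset.induction with
    | empty => simp
    | cons a t ih =>
      intro _
      rcases eq_or_ne t 0 with rfl | ht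
      · simp
      · rw [Multiset.sup_cons, Multiset.mem_cons]
        rcases le_total a t.sup with h | h
        · exact Or.inr (by rw [sup_eq_right.2 h]; exact ih ht)
        · exact Or.inl (sup_eq_left.2 h)
  refine key _ fun h => hn ?_
  rw [← p.parts_sum, h, Multiset.sum_zero]

lemma zero_mk_mem_partitionDiagram {p : n.Partition} (hn : n ≠ 0) {j : ℕ} (hj : j < firstPart p) :
    (0, j) ∈ partitionDiagram p := by
  obtain ⟨i, hi, h⟩ := List.getElem_of_mem
    ((Multiset.mem_sort (· ≥ ·)).2 (firstPart_mem_parts p hn))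
  exact (partitionDiagram p).up_left_mem (Nat.zero_le i) le_rfl
    (YoungDiagram.mem_ofRowLens.2 ⟨hi, by simpa only [h] using hj⟩)

/-- A partition with first part at least `n - 1` is `(n)` or `(n - 1, 1)`. -/
lemma firstPart_eq_or_eq_standardPartition (hn : 2 ≤ n) {p : n.Partition}
    (hp : n - 1 ≤ firstPart p) : firstPart p = n ∨ p = standardPartition n hn := by
  obtain ⟨t, ht⟩ := Multiset.exists_cons_of_mem (firstPart_mem_parts p (by omega))
  have hsum := p.parts_sum
  rw [ht, Multiset.sum_cons] at hsum
  by_cases h : firstPart p = n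
  · exact Or.inl h
  · refine Or.inr ?_
    have ht1 : t.sum = 1 := by omega
    have hpos : ∀ x ∈ t, x = 1 := fun x hx => by
      have h1 := Multiset.single_le_sum (fun _ _ => Nat.zero_le _) x hx
      have h2 := p.parts_pos (i := x) (by rw [ht]; exact Multiset.mem_cons_of_mem hx)
      omega
    have hrep := Multiset.eq_replicate_card.2 hpos
    have hcard : t.card = 1 := by
      rw [hrep, Multiset.sum_replicate] at ht1
      simpa using ht1
    ext1
    rw [ht, hrep, hcard, show firstPart p = n - 1 by omega]
    rfl

end Partition

/-! ### Row sums, column sums and Young symmetrizers -/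

open GroupAlgebra

section FiberSum

variable {n : ℕ} {β γ : Type*}

/-- The sign of a permutation as a real number. -/
def realSign (n : ℕ) : Perm (Fin n) →* ℝ :=
  (Int.castRingHom ℝ).toMonoidHom.comp ((Units.coeHom ℤ).comp Perm.sign)

lemma realSign_inv (σ : Perm (Fin n)) : realSign n σ⁻¹ = realSign n σ := by
  simp [realSign]

open Classical in
/-- The sum `∑ χ(σ) σ` over the permutations that preserve the fibers of `f`. -/
def fiberSum (f : Fin n → β) (χ : Perm (Fin n) →* ℝ) : SymAlgebra n :=
  ∑ σ : Perm (Fin n) with ∀ k, f (σ k) = f k, MonoidAlgebra.single σ (χ σ)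

lemma rowSum_eq_fiberSum {p : n.Partition} (T : Tableau p) :
    rowSum T = fiberSum (fun k => (T k).1.1) 1 :=
  Finset.sum_congr (by ext; simp) fun _ _ => rfl

lemma columnSum_eq_fiberSum {p : n.Partition} (T : Tableau p) :
    columnSum T = fiberSum (fun k => (T k).1.2) (realSign n) :=
  Finset.sum_congr (by ext; simp) fun _ _ => rfl

open Classical in
lemma coeff_fiberSum (f : Fin n → β) (χ : Perm (Fin n) →* ℝ) (σ : Perm (Fin n)) :
    (fiberSum f χ).coeff σ = if ∀ k, f (σ k) = f k then χ σ else 0 := by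
  simp [fiberSum, MonoidAlgebra.coeff_sum, Finsupp.single_apply]

lemma fiber_of_coeff_fiberSum_ne_zero {f : Fin n → β} {χ : Perm (Fin n) →* ℝ} {σ : Perm (Fin n)}
    (h : (fiberSum f χ).coeff σ ≠ 0) : ∀ k, f (σ k) = f k := by
  classical
  by_contra hσ
  exact h (by rw [coeff_fiberSum, if_neg hσ])

lemma coeff_fiberSum_one (f : Fin n → β) (χ : Perm (Fin n) →* ℝ) : (fiberSum f χ).coeff 1 = 1 := by
  simp [coeff_fiberSum]

lemma forall_fiber_inv_iff (f : Fin n → β) {σ : Perm (Fin n)} :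
    (∀ k, f (σ⁻¹ k) = f k) ↔ ∀ k, f (σ k) = f k :=
  ⟨fun h k => by simpa using (h (σ k)).symm, fun h k => by simpa using (h (σ⁻¹ k)).symm⟩

lemma adj_fiberSum (f : Fin n → β) {χ : Perm (Fin n) →* ℝ} (hχ : ∀ σ, χ σ⁻¹ = χ σ) :
    adj (fiberSum f χ) = fiberSum f χ := by
  classical
  ext σ
  simp only [coeff_adj, coeff_fiberSum, forall_fiber_inv_iff f, hχ]

lemma single_mul_fiberSum (f : Fin n → β) (χ : Perm (Fin n) →* ℝ) {τ : Perm (Fin n)}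
    (hτ : ∀ k, f (τ k) = f k) :
    MonoidAlgebra.single τ 1 * fiberSum f χ = χ τ⁻¹ • fiberSum f χ := by
  classical
  ext σ
  have h : (∀ k, f ((τ⁻¹ * σ) k) = f k) ↔ ∀ k, f (σ k) = f k := by
    have h1 := (forall_fiber_inv_iff f).2 hτ
    simp only [Perm.mul_apply, h1]
  rw [MonoidAlgebra.coeff_single_mul_apply, MonoidAlgebra.coeff_smul_apply, coeff_fiberSum,
    coeff_fiberSum]
  simp only [h, map_mul, one_mul, smul_eq_mul, mul_ite, mul_zero]

lemma fiberSum_mul_single (f : Fin n → β) (χ : Perm (Fin n) →* ℝ) {τ : Perm (Fin n)}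
    (hτ : ∀ k, f (τ k) = f k) :
    fiberSum f χ * MonoidAlgebra.single τ 1 = χ τ⁻¹ • fiberSum f χ := by
  classical
  ext σ
  have h : (∀ k, f ((σ * τ⁻¹) k) = f k) ↔ ∀ k, f (σ k) = f k := by
    have h1 := (forall_fiber_inv_iff f).2 hτ
    refine ⟨fun h k => ?_, fun h k => ?_⟩
    · have := h (τ k)
      simpa [hτ] using this
    · rw [Perm.mul_apply, h, h1]
  rw [MonoidAlgebra.coeff_mul_single_apply, MonoidAlgebra.coeff_smul_apply, coeff_fiberSum,
    coeff_fiberSum]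
  simp only [h, map_mul, mul_one, smul_eq_mul, mul_ite, mul_zero, mul_comm (χ σ)]

lemma swap_fiber (f : Fin n → β) {i j : Fin n} (h : f i = f j) (k : Fin n) :
    f (swap i j k) = f k := by
  rcases eq_or_ne k i with rfl | hi
  · rw [swap_apply_left, h]
  rcases eq_or_ne k j with rfl | hj
  · rw [swap_apply_right, h]
  · rw [swap_apply_of_ne_of_ne hi hj]

lemma eq_zero_of_eq_neg_one_smul {x : SymAlgebra n} (h : x = (-1 : ℝ) • x) : x = 0 := by
  have h2 : (2 : ℝ) • x = 0 := by
    rw [two_smul]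
    nth_rewrite 2 [h]
    rw [neg_one_smul, add_neg_cancel]
  exact (smul_eq_zero.1 h2).resolve_left two_ne_zero

lemma single_mul_single_swap (g : Perm (Fin n)) (i j : Fin n) :
    (MonoidAlgebra.single g 1 * MonoidAlgebra.single (swap i j) 1 : SymAlgebra n) =
      MonoidAlgebra.single (swap (g i) (g j)) 1 * MonoidAlgebra.single g 1 := by
  rw [MonoidAlgebra.single_mul_single, MonoidAlgebra.single_mul_single, swap_apply_apply,
    inv_mul_cancel_right]

lemma realSign_swap_inv {i j : Fin n} (h : i ≠ j) : realSign n (swap i j)⁻¹ = -1 := by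
  simp [realSign, Perm.sign_swap h]

/-- The transposition of i and j is absorbed by the right factor; moved across g it becomes the
transposition of g i and g j, which negates the left factor. The product equals its own negative. -/
lemma fiberSum_sign_mul_single_mul_fiberSum (f : Fin n → β) (f' : Fin n → γ) {g : Perm (Fin n)}
    {i j : Fin n} (hij : i ≠ j) (hf : f (g i) = f (g j)) (hf' : f' i = f' j) :
    fiberSum f (realSign n) * MonoidAlgebra.single g 1 * fiberSum f' 1 = 0 := by
  refine eq_zero_of_eq_neg_one_smul ?_
  have h1 := single_mul_fiberSum f' 1 (swap_fiber f' hf')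
  have h2 := fiberSum_mul_single f (realSign n) (swap_fiber f hf)
  rw [MonoidHom.one_apply, one_smul] at h1
  rw [realSign_swap_inv (g.injective.ne hij)] at h2
  conv_lhs => rw [← h1, ← mul_assoc, mul_assoc (fiberSum f _), single_mul_single_swap, ← mul_assoc,
    h2]
  simp only [smul_mul_assoc]

lemma fiberSum_mul_single_mul_fiberSum_sign (f : Fin n → β) (f' : Fin n → γ) {g : Perm (Fin n)}
    {i j : Fin n} (hij : i ≠ j) (hf : f (g i) = f (g j)) (hf' : f' i = f' j) :
    fiberSum f 1 * MonoidAlgebra.single g 1 * fiberSum f' (realSign n) = 0 := by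
  refine eq_zero_of_eq_neg_one_smul ?_
  have h1 := fiberSum_mul_single f 1 (swap_fiber f hf)
  have h2 := single_mul_fiberSum f' (realSign n) (swap_fiber f' hf')
  rw [MonoidHom.one_apply, one_smul] at h1
  rw [realSign_swap_inv hij] at h2
  conv_lhs => rw [← h1, mul_assoc (fiberSum f _), ← single_mul_single_swap, ← mul_assoc, mul_assoc,
    h2]
  simp only [mul_smul_comm]

end FiberSum

/-! ### Orthogonality and primitivity of Young symmetrizers -/

section YoungSymmetrizer

variable {n : ℕ} {p q : n.Partition}

lemma adj_youngSymmetrizer (T : Tableau p) : adj (youngSymmetrizer T) = columnSum T * rowSum T := by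
  rw [youngSymmetrizer, adj_mul, columnSum_eq_fiberSum, rowSum_eq_fiberSum,
    adj_fiberSum _ realSign_inv, adj_fiberSum _ fun _ => rfl]

lemma mul_mul_eq_zero_of_forall_single {a b : SymAlgebra n}
    (h : ∀ g, a * MonoidAlgebra.single g 1 * b = 0) (x : SymAlgebra n) : a * x * b = 0 :=
  kills_of_forall_single h x

/-- If no transposition kills the term at g, entries sharing a row of `T'` lie in distinct columns
of `T ∘ g`, so p dominates q, against `hk`. -/
lemma columnSum_mul_rowSum_eq_zero (T : Tableau p) (T' : Tableau q) {k : ℕ}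
    (hk : ((partitionDiagram p).cells.filter fun c => c.1 < k).card <
      ((partitionDiagram q).cells.filter fun c => c.1 < k).card) (x : SymAlgebra n) :
    columnSum T * x * rowSum T' = 0 := by
  refine mul_mul_eq_zero_of_forall_single (fun g => ?_) x
  by_contra hne
  refine hk.not_ge (YoungDiagram.card_filter_row_lt_le T' (g.trans T) (fun i j hr hc => ?_) k)
  by_contra hij
  refine hne ?_
  rw [columnSum_eq_fiberSum, rowSum_eq_fiberSum]
  exact fiberSum_sign_mul_single_mul_fiberSum _ _ hij hc hr

lemma rowSum_mul_columnSum_eq_zero (T : Tableau p) (T' : Tableau q) {k : ℕ}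
    (hk : ((partitionDiagram q).cells.filter fun c => c.1 < k).card <
      ((partitionDiagram p).cells.filter fun c => c.1 < k).card) (x : SymAlgebra n) :
    rowSum T * x * columnSum T' = 0 := by
  refine mul_mul_eq_zero_of_forall_single (fun g => ?_) x
  by_contra hne
  refine hk.not_ge (YoungDiagram.card_filter_row_lt_le (g.trans T) T' (fun i j hr hc => ?_) k)
  by_contra hij
  refine hne ?_
  rw [columnSum_eq_fiberSum, rowSum_eq_fiberSum]
  exact fiberSum_mul_single_mul_fiberSum_sign _ _ hij hr hc

/-- The product is C R x R' C'. The shapes differ in the size of their first k rows for some k;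
depending on which is larger, C…R' or R…C' vanishes. -/
lemma kills_adj_youngSymmetrizer (hpq : p ≠ q) (T : Tableau p) (T' : Tableau q) :
    Kills (adj (youngSymmetrizer T)) (youngSymmetrizer T') := fun x => by
  have h : ∃ k, ((partitionDiagram p).cells.filter fun c => c.1 < k).card ≠
      ((partitionDiagram q).cells.filter fun c => c.1 < k).card := by
    by_contra! h
    exact hpq (partitionDiagram_injective (YoungDiagram.eq_of_card_filter_row_lt_eq h))
  obtain ⟨k, hk⟩ := h
  rw [adj_youngSymmetrizer, youngSymmetrizer]
  rcases lt_or_gt_of_ne hk with hk | hk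
  · rw [mul_assoc (columnSum T), ← mul_assoc, columnSum_mul_rowSum_eq_zero T T' hk, zero_mul]
  · rw [← mul_assoc, mul_assoc _ x, mul_assoc (columnSum T), mul_assoc (columnSum T),
      rowSum_mul_columnSum_eq_zero T T' hk, mul_zero]

/-- Only the identity preserves both rows and columns, so the coefficient at 1 is 1. -/
lemma youngSymmetrizer_ne_zero (T : Tableau p) : youngSymmetrizer T ≠ 0 := fun h => by
  classical
  have h1 : (youngSymmetrizer T).coeff 1 = 1 := by
    rw [youngSymmetrizer, rowSum_eq_fiberSum, columnSum_eq_fiberSum, coeff_mul_eq_sum,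
      Finset.sum_eq_single 1]
    · rw [inv_one, one_mul, coeff_fiberSum_one, coeff_fiberSum_one, one_mul]
    · intro σ _ hσ
      rw [mul_one]
      by_contra hne
      obtain ⟨hr, hc⟩ := mul_ne_zero_iff.1 hne
      replace hr := fiber_of_coeff_fiberSum_ne_zero hr
      replace hc := (forall_fiber_inv_iff fun k => (T k).1.2).1 (fiber_of_coeff_fiberSum_ne_zero hc)
      exact hσ (Perm.ext fun k => T.injective (Subtype.ext (Prod.ext (hr k) (hc k))))
    · simp
  simp [h] at h1

lemma exists_rowSum_mul_single_mul_columnSum (T : Tableau p) (g : Perm (Fin n)) :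
    ∃ s : ℝ, rowSum T * MonoidAlgebra.single g 1 * columnSum T = s • youngSymmetrizer T := by
  by_cases h : ∀ i j, (T (g i)).1.1 = (T (g j)).1.1 → (T i).1.2 = (T j).1.2 → i = j
  · have hmem := YoungDiagram.mk_row_col_mem (g.trans T) T h
    -- Von Neumann's lemma: `Q` moves x within its column to the row of g x. This factors g as a row
    -- permutation times a column permutation.
    let Q : Fin n → Fin n := fun x => T.symm ⟨_, hmem x⟩
    have hQ (x : Fin n) : (T (Q x)).1 = ((T (g x)).1.1, (T x).1.2) := by simp [Q]
    have hQinj : Function.Injective Q := fun x y hxy => by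
      have h1 := hQ x
      rw [hxy, hQ y, Prod.mk.injEq] at h1
      exact (h y x h1.1 h1.2).symm
    let c : Perm (Fin n) := Equiv.ofBijective Q (Finite.injective_iff_bijective.1 hQinj)
    have hc (k : Fin n) : (T (c k)).1.2 = (T k).1.2 := by
      simp [c, hQ]
    have hr (k : Fin n) : (T ((c * g⁻¹) k)).1.1 = (T k).1.1 := by
      simp [c, hQ]
    have hr' := (forall_fiber_inv_iff fun k => (T k).1.1).2 hr
    have hg : MonoidAlgebra.single g (1 : ℝ) =
        MonoidAlgebra.single (c * g⁻¹)⁻¹ 1 * MonoidAlgebra.single c 1 := by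
      rw [MonoidAlgebra.single_mul_single, mul_one, mul_inv_rev, inv_inv, inv_mul_cancel_right]
    refine ⟨realSign n c⁻¹, ?_⟩
    rw [hg, youngSymmetrizer, rowSum_eq_fiberSum, columnSum_eq_fiberSum, ← mul_assoc,
      fiberSum_mul_single (fun k => (T k).1.1) 1 hr', mul_assoc,
      single_mul_fiberSum (fun k => (T k).1.2) _ hc, MonoidHom.one_apply, one_smul,
      mul_smul_comm]
  · push Not at h
    obtain ⟨i, j, hr, hc, hij⟩ := h
    refine ⟨0, ?_⟩
    rw [zero_smul, columnSum_eq_fiberSum, rowSum_eq_fiberSum]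
    exact fiberSum_mul_single_mul_fiberSum_sign _ _ hij hr hc

/-- Regroup R C x R C as R (C x R) C and expand the middle factor over group elements. -/
lemma exists_youngSymmetrizer_mul_mul (T : Tableau p) (x : SymAlgebra n) :
    ∃ s : ℝ, youngSymmetrizer T * x * youngSymmetrizer T = s • youngSymmetrizer T := by
  choose s hs using exists_rowSum_mul_single_mul_columnSum T
  have key (y : SymAlgebra n) : rowSum T * y * columnSum T =
      (∑ g, y.coeff g * s g) • youngSymmetrizer T := by
    conv_lhs => rw [eq_sum_smul_single y]
    simp only [Finset.mul_sum, Finset.sum_mul, mul_smul_comm, smul_mul_assoc, hs, Finset.sum_smul,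
      smul_smul]
  refine ⟨_, Eq.trans ?_ (key (columnSum T * x * rowSum T))⟩
  simp only [youngSymmetrizer, mul_assoc]

end YoungSymmetrizer

/-! ### Dimension of the center -/

section Center

variable {n : ℕ}

lemma coeff_eq_of_isConj {z : SymAlgebra n} (hz : z ∈ Subalgebra.center ℝ (SymAlgebra n))
    {σ τ : Perm (Fin n)} (h : IsConj σ τ) : z.coeff σ = z.coeff τ := by
  obtain ⟨g, rfl⟩ := isConj_iff.1 h
  have h1 := Subalgebra.mem_center_iff.1 hz (MonoidAlgebra.single g 1)
  have h2 := congrArg (fun y => y.coeff (g * σ)) h1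
  simpa [MonoidAlgebra.coeff_single_mul_apply, MonoidAlgebra.coeff_mul_single_apply] using h2

/-- The center of `ℝ[S_n]` has dimension at most the number of partitions of `n`. -/
lemma finrank_center_le :
    Module.finrank ℝ (Subalgebra.center ℝ (SymAlgebra n)) ≤ Fintype.card n.Partition := by
  classical
  -- One representative per cycle type determines a central element. The default 1 is never reached
  -- at a type of the form `σ.partition`.
  let rep : (Fintype.card (Fin n)).Partition → Perm (Fin n) := fun q =>
    if h : ∃ σ : Perm (Fin n), σ.partition = q then h.choose else 1
  have hrep (σ : Perm (Fin n)) : IsConj (rep σ.partition) σ := by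
    have h : ∃ τ : Perm (Fin n), τ.partition = σ.partition := ⟨σ, rfl⟩
    rw [Perm.partition_eq_of_isConj]
    simp only [rep, dif_pos h, h.choose_spec]
  let F : Subalgebra.center ℝ (SymAlgebra n) →ₗ[ℝ] ((Fintype.card (Fin n)).Partition → ℝ) :=
    { toFun := fun z q => z.1.coeff (rep q)
      map_add' := fun x y => by ext; simp
      map_smul' := fun r x => by ext; simp }
  have hF : Function.Injective F := fun x y hxy => by
    refine Subtype.ext (MonoidAlgebra.coeff_injective (Finsupp.ext fun σ => ?_))
    rw [← coeff_eq_of_isConj x.2 (hrep σ), ← coeff_eq_of_isConj y.2 (hrep σ)]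
    exact congrFun hxy σ.partition
  refine (LinearMap.finrank_le_finrank_of_injective hF).trans ?_
  rw [Module.finrank_fintype_fun_eq_card, Fintype.card_fin]

end Center

/-! ### Completeness of the Specht modules -/

section SpechtFamily

variable {n : ℕ} (T : ∀ p : n.Partition, Tableau p)

theorem exists_center_mul_youngSymmetrizer {z : SymAlgebra n}
    (hz : z ∈ Subalgebra.center ℝ (SymAlgebra n)) (p : n.Partition) :
    ∃ s : ℝ, ∀ x, z * x * youngSymmetrizer (T p) = s • (x * youngSymmetrizer (T p)) :=
  exists_center_mul_eq_smul (c := fun p => youngSymmetrizer (T p))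
    (fun p => youngSymmetrizer_ne_zero (T p))
    (fun p q hpq => kills_adj_youngSymmetrizer hpq (T p) (T q)) finrank_center_le hz p

theorem eq_zero_of_forall_kills_youngSymmetrizer {x : SymAlgebra n}
    (hx : ∀ p, Kills x (youngSymmetrizer (T p))) : x = 0 :=
  eq_zero_of_forall_kills (c := fun p => youngSymmetrizer (T p))
    (fun p => youngSymmetrizer_ne_zero (T p))
    (fun p q hpq => kills_adj_youngSymmetrizer hpq (T p) (T q)) finrank_center_le hx

end SpechtFamily

/-! ### Functions of the form `π ↦ ∑ i, a i (π i)` -/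

section Perp

variable {n : ℕ}

/-- The element `∑ b(π) π` of the group algebra. -/
def ofFun (b : Perm (Fin n) → ℝ) : SymAlgebra n := ∑ π, MonoidAlgebra.single π (b π)

@[simp] lemma coeff_ofFun (b : Perm (Fin n) → ℝ) (π : Perm (Fin n)) : (ofFun b).coeff π = b π := by
  classical
  simp [ofFun, MonoidAlgebra.coeff_sum, Finsupp.single_apply]

/-- The sum of the members of `D` in the group algebra. -/
def indicatorSum (D : Finset (Perm (Fin n))) : SymAlgebra n := ∑ π ∈ D, MonoidAlgebra.single π 1

lemma coeff_indicatorSum (D : Finset (Perm (Fin n))) (π : Perm (Fin n)) :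
    (indicatorSum D).coeff π = if π ∈ D then 1 else 0 := by
  classical
  simp [indicatorSum, MonoidAlgebra.coeff_sum, Finsupp.single_apply]

/-- The permutations that send `i` to `j`. -/
def pointCoset (i j : Fin n) : Finset (Perm (Fin n)) := Finset.univ.filter fun π => π i = j

@[simp] lemma mem_pointCoset {i j : Fin n} {π : Perm (Fin n)} : π ∈ pointCoset i j ↔ π i = j := by
  simp [pointCoset]

/-- The coefficients of `b` sum to zero over every set `{π | π i = j}`. -/
def Perp (b : SymAlgebra n) : Prop := ∀ i j, ∑ π ∈ pointCoset i j, b.coeff π = 0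

lemma fiber_eq_iff {k : Fin n} {σ : Perm (Fin n)} : (∀ x, (σ x = k) = (x = k)) ↔ σ k = k := by
  refine ⟨fun h => (h k).symm ▸ rfl, fun h x => propext ⟨fun hx => ?_, fun hx => hx ▸ h⟩⟩
  exact σ.injective (hx.trans h.symm)

/-- The sum of the stabilizer of `k`. -/
def stabSum (k : Fin n) : SymAlgebra n := fiberSum (fun x => x = k) 1

lemma coeff_stabSum (k : Fin n) (σ : Perm (Fin n)) :
    (stabSum k).coeff σ = if σ k = k then 1 else 0 := by
  classical
  rw [stabSum, coeff_fiberSum]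
  split_ifs with h1 h2 h2
  · rfl
  · exact absurd (fiber_eq_iff.1 h1) h2
  · exact absurd (fiber_eq_iff.2 h2) h1
  · rfl

lemma stabSum_eq_indicatorSum (k : Fin n) : stabSum k = indicatorSum (pointCoset k k) := by
  ext σ
  simp [coeff_stabSum, coeff_indicatorSum]

lemma Perp.mul_single {b : SymAlgebra n} (hb : Perp b) (g : Perm (Fin n)) :
    Perp (b * MonoidAlgebra.single g 1) := fun i j => by
  rw [← hb (g i) j]
  refine Finset.sum_equiv (Equiv.mulRight g⁻¹) (fun π => ?_) fun π _ => ?_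
  · simp
  · simp [MonoidAlgebra.coeff_mul_single_apply]

/-- The coefficient at h is the sum of b over {g | g k = h k}. -/
lemma Perp.mul_stabSum {b : SymAlgebra n} (hb : Perp b) (k : Fin n) : b * stabSum k = 0 := by
  ext h
  rw [coeff_mul_eq_sum, MonoidAlgebra.coeff_zero, Finsupp.zero_apply, ← hb k (h k), pointCoset,
    Finset.sum_filter]
  refine Finset.sum_congr rfl fun g _ => ?_
  rw [coeff_stabSum, mul_ite, mul_one, mul_zero]
  refine if_congr ?_ rfl rfl
  rw [Perm.mul_apply, Perm.inv_eq_iff_eq, eq_comm]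

lemma le_card_row_eq_zero {p : n.Partition} {m : ℕ} (hn : n ≠ 0) (hm : m ≤ firstPart p)
    (T : Tableau p) : m ≤ (Finset.univ.filter fun x => (T x).1.1 = 0).card := by
  rw [← Finset.card_range m]
  have hmem (j : ℕ) (hj : j ∈ Finset.range m) : (0, j) ∈ (partitionDiagram p).cells :=
    zero_mk_mem_partitionDiagram hn ((Finset.mem_range.1 hj).trans_le hm)
  refine Finset.card_le_card_of_forall_subsingleton (fun j x => (T x).1 = (0, j))
    (fun j hj => ⟨T.symm ⟨_, hmem j hj⟩, by simp, by simp⟩) fun x _ j hj j' hj' => ?_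
  have h := hj.2.symm.trans hj'.2
  simpa using h

lemma row_eq_zero_of_firstPart_eq {p : n.Partition} (hp : firstPart p = n) (T : Tableau p)
    (x : Fin n) : (T x).1.1 = 0 := by
  have h := le_card_row_eq_zero (Nat.pos_iff_ne_zero.1 x.pos) hp.ge T
  have h1 := Finset.eq_univ_of_card _
    (((Finset.card_le_univ _).trans (Fintype.card_fin n).le).antisymm h |>.trans
      (Fintype.card_fin n).symm)
  exact (Finset.mem_filter.1 (h1.symm.subset (Finset.mem_univ x))).2

lemma exists_row_eq_zero {p : n.Partition} (hn : 2 ≤ n) (hp : n - 1 ≤ firstPart p)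
    (T : Tableau p) : ∃ k, ∀ x, x ≠ k → (T x).1.1 = 0 := by
  classical
  set R : Finset (Fin n) := Finset.univ.filter fun x => (T x).1.1 = 0 with hR
  have hcard : n - 1 ≤ R.card := le_card_row_eq_zero (by omega) hp T
  have hcompl : Rᶜ.card ≤ 1 := by
    rw [Finset.card_compl, Fintype.card_fin]
    omega
  rcases Finset.eq_empty_or_nonempty Rᶜ with h | ⟨k, hk⟩
  · refine ⟨⟨0, by omega⟩, fun x _ => ?_⟩
    have hx : x ∉ Rᶜ := by simp [h]
    simpa [hR] using hx
  · refine ⟨k, fun x hx => ?_⟩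
    by_contra h
    exact hx (Finset.card_le_one.1 hcompl x (by simpa [hR] using h) k hk)

/-- All entries except possibly one, k, lie in the top row, so the stabilizer of k preserves rows.
Hence `rowSum T` absorbs `stabSum k`, which every translate of b annihilates. -/
lemma Perp.kills {b : SymAlgebra n} (hb : Perp b) (hn : 2 ≤ n) {p : n.Partition}
    (hp : n - 1 ≤ firstPart p) (T : Tableau p) : Kills b (youngSymmetrizer T) := by
  refine kills_of_forall_single fun g => ?_
  obtain ⟨k, hk⟩ := exists_row_eq_zero hn hp T
  have hrow {σ : Perm (Fin n)} (hσ : σ k = k) (x : Fin n) : (T (σ x)).1.1 = (T x).1.1 := by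
    rcases eq_or_ne x k with rfl | hx
    · rw [hσ]
    · rw [hk x hx, hk (σ x) fun h => hx (σ.injective (h.trans hσ.symm))]
  have habs : stabSum k * rowSum T = ((pointCoset k k).card : ℝ) • rowSum T := by
    rw [stabSum_eq_indicatorSum, indicatorSum, Finset.sum_mul, rowSum_eq_fiberSum,
      Finset.sum_congr rfl fun σ hσ =>
        single_mul_fiberSum (fun k => (T k).1.1) 1 (hrow (mem_pointCoset.1 hσ))]
    simp only [MonoidHom.one_apply, one_smul, Finset.sum_const, Nat.cast_smul_eq_nsmul]
  have hcard : ((pointCoset k k).card : ℝ) ≠ 0 := by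
    rw [Nat.cast_ne_zero, ← Nat.pos_iff_ne_zero, Finset.card_pos]
    exact ⟨1, by simp⟩
  have h0 : b * MonoidAlgebra.single g 1 * rowSum T = 0 := by
    refine (smul_eq_zero.1 ?_).resolve_left hcard
    rw [← mul_smul_comm, ← habs, ← mul_assoc, (hb.mul_single g).mul_stabSum, zero_mul]
  rw [youngSymmetrizer, ← mul_assoc, h0, zero_mul]

/-- For a single row, `rowSum T` is the sum of the whole group. -/
lemma kills_of_sum_coeff_eq_zero {b : SymAlgebra n} (hb : ∑ π, b.coeff π = 0) {p : n.Partition}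
    (hp : firstPart p = n) (T : Tableau p) : Kills b (youngSymmetrizer T) := by
  have hrow (σ : Perm (Fin n)) (x : Fin n) : (T (σ x)).1.1 = (T x).1.1 := by
    rw [row_eq_zero_of_firstPart_eq hp, row_eq_zero_of_firstPart_eq hp]
  have h0 : b * rowSum T = 0 := by
    ext h
    rw [coeff_mul_eq_sum, MonoidAlgebra.coeff_zero, Finsupp.zero_apply, ← hb]
    refine Finset.sum_congr rfl fun g _ => ?_
    rw [rowSum_eq_fiberSum, coeff_fiberSum, if_pos (hrow _), MonoidHom.one_apply, mul_one]
  refine kills_of_forall_single fun g => ?_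
  rw [youngSymmetrizer, ← mul_assoc, mul_assoc b, rowSum_eq_fiberSum,
    single_mul_fiberSum (fun k => (T k).1.1) 1 (hrow g), MonoidHom.one_apply, one_smul,
    ← rowSum_eq_fiberSum, h0, zero_mul]

/-- Pigeonhole: the n - 1 entries other than g⁻¹ k occupy fewer than n - 1 columns, so two share a
column, and their transposition after transport by g fixes k. -/
lemma kills_stabSum {p : n.Partition} (hp : firstPart p < n - 1) (T : Tableau p) (k : Fin n) :
    Kills (stabSum k) (youngSymmetrizer T) := fun x => by
  rw [youngSymmetrizer, ← mul_assoc, mul_assoc (stabSum k), columnSum_eq_fiberSum, stabSum]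
  refine mul_mul_eq_zero_of_forall_single (fun g => ?_) _
  obtain ⟨i, hi, j, hj, hij, hcol⟩ := Finset.exists_ne_map_eq_of_card_lt_of_maps_to
    (s := Finset.univ.erase (g⁻¹ k)) (t := Finset.range (firstPart p)) (f := fun x => (T x).1.2)
    (by rw [Finset.card_erase_of_mem (Finset.mem_univ _), Finset.card_univ, Fintype.card_fin,
      Finset.card_range]; exact hp)
    (fun x _ => by simpa using snd_lt_firstPart (T x).2)
  have hne {x : Fin n} (hx : x ∈ Finset.univ.erase (g⁻¹ k)) : (g x = k) = False := by
    rw [eq_iff_iff, iff_false, ← Perm.eq_inv_iff_eq]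
    exact Finset.ne_of_mem_erase hx
  exact fiberSum_mul_single_mul_fiberSum_sign _ _ hij (by rw [hne hi, hne hj]) hcol

lemma kills_pointCoset {p : n.Partition} (hp : firstPart p < n - 1) (T : Tableau p)
    (i j : Fin n) : Kills (indicatorSum (pointCoset i j)) (youngSymmetrizer T) := by
  have h : indicatorSum (pointCoset i j) = MonoidAlgebra.single (swap i j) 1 * stabSum i := by
    ext σ
    rw [MonoidAlgebra.coeff_single_mul_apply, coeff_stabSum, coeff_indicatorSum]
    simp [swap_apply_eq_iff]
  rw [h]
  exact (kills_stabSum hp T i).mul_left _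

lemma kills_adj {f c : SymAlgebra n} (h : Kills f c) : Kills (adj f) c := fun x => by
  by_contra hne
  refine adj_mul_self_ne_zero hne ?_
  have h1 := h (adj f * x)
  rw [adj_mul, adj_mul, adj_adj]
  simp only [mul_assoc] at h1 ⊢
  rw [h1, mul_zero, mul_zero]

/-- The sum is the trace of `adj f * b`, an element that annihilates every Specht module. -/
lemma sum_coeff_mul_coeff_eq_zero (T : ∀ p : n.Partition, Tableau p) {f b : SymAlgebra n}
    (h : ∀ p, Kills f (youngSymmetrizer (T p)) ∨ Kills b (youngSymmetrizer (T p))) :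
    ∑ π, f.coeff π * b.coeff π = 0 := by
  have h0 : adj f * b = 0 := eq_zero_of_forall_kills_youngSymmetrizer T fun p =>
    (h p).elim (fun h => (kills_adj h).mul_right b) fun h => h.mul_left _
  have h1 : (adj f * b).coeff 1 = 0 := by rw [h0]; rfl
  rw [coeff_mul_eq_sum, ← Equiv.sum_comp (Equiv.inv _)] at h1
  simpa [coeff_adj] using h1

end Perp

/-- Double orthogonal complement: a function outside the span is separated from it by a functional,
represented by some b. -/
lemma exists_eq_sum_of_forall_perp {κ V : Type*} [Fintype κ] [Fintype V] (w : κ → V → ℝ)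
    (φ : V → ℝ) (h : ∀ b : V → ℝ, (∀ k, ∑ v, w k v * b v = 0) → ∑ v, φ v * b v = 0) :
    ∃ α : κ → ℝ, ∀ v, φ v = ∑ k, α k * w k v := by
  classical
  by_cases hφ : φ ∈ Submodule.span ℝ (Set.range w)
  · obtain ⟨α, rfl⟩ := (Submodule.mem_span_range_iff_exists_fun ℝ).1 hφ
    exact ⟨α, fun v => by simp⟩
  · obtain ⟨l, hl, hle⟩ := Submodule.exists_le_ker_of_notMem hφ
    have hrep (ψ : V → ℝ) : l ψ = ∑ v, ψ v * l (Pi.single v 1) := by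
      conv_lhs => rw [pi_eq_sum_univ' ψ, map_sum]
      exact Finset.sum_congr rfl fun v _ => by rw [map_smul, smul_eq_mul]
    refine absurd ?_ hl
    rw [hrep]
    refine h _ fun k => ?_
    rw [← hrep]
    exact hle (Submodule.subset_span ⟨k, rfl⟩)

/-! ### Indicators that are linear in the permutation matrix -/

section Span

variable {n : ℕ}

lemma sum_ite_mul_eq (i j : Fin n) (b : Perm (Fin n) → ℝ) :
    ∑ π, (if π i = j then 1 else 0) * b π = ∑ π ∈ pointCoset i j, b π := by
  simp [pointCoset, Finset.sum_filter]

lemma exists_eq_sum_apply {φ : Perm (Fin n) → ℝ}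
    (h : ∀ b : SymAlgebra n, Perp b → ∑ π, φ π * b.coeff π = 0) :
    ∃ a : Fin n → Fin n → ℝ, ∀ π, φ π = ∑ i, a i (π i) := by
  obtain ⟨α, hα⟩ := exists_eq_sum_of_forall_perp
    (fun (ij : Fin n × Fin n) (π : Perm (Fin n)) => if π ij.1 = ij.2 then (1 : ℝ) else 0) φ
    fun b hb => by
      simpa using h (ofFun b) fun i j => by
        simpa only [sum_ite_mul_eq, coeff_ofFun] using hb (i, j)
  refine ⟨fun i j => α (i, j), fun π => ?_⟩
  rw [hα, Fintype.sum_prod_type]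
  simp

/-- A set whose indicator function has the form `π ↦ ∑ i, a i (π i)` contains, with every `π`, all
the permutations that agree with `π` at some point. -/
lemma exists_forall_apply_eq_mem (hn : 2 ≤ n) {D : Finset (Perm (Fin n))} {a : Fin n → Fin n → ℝ}
    (ha : ∀ π : Perm (Fin n), (if π ∈ D then (1 : ℝ) else 0) = ∑ i, a i (π i))
    {π : Perm (Fin n)} (hπ : π ∈ D) :
    ∃ i, ∀ σ : Perm (Fin n), σ i = π i → σ ∈ D := by
  by_contra! hcon
  choose τ hτ hτD using hcon
  let F : Matrix (Fin n) (Fin n) ℝ →ₗ[ℝ] ℝ :=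
    { toFun := fun M => ∑ i, ∑ j, a i j * M i j
      map_add' := fun M N => by simp [mul_add, Finset.sum_add_distrib]
      map_smul' := fun r M => by simp [Finset.mul_sum, mul_left_comm] }
  have hF (σ : Perm (Fin n)) : F (σ.permMatrix ℝ) = if σ ∈ D then 1 else 0 := by
    rw [ha]
    simp [F, Equiv.Perm.permMatrix, PEquiv.toMatrix_apply]
  have hn' : (0 : ℝ) < n - 1 := by
    have : (2 : ℝ) ≤ n := by exact_mod_cast hn
    linarith
  -- Since τ_k agrees with π at k, subtracting the matrix of π leaves nonnegative entries; rows and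
  -- columns then sum to n - 1.
  set N : Matrix (Fin n) (Fin n) ℝ :=
    (n - 1 : ℝ)⁻¹ • (∑ k, (τ k).permMatrix ℝ - π.permMatrix ℝ) with hN
  have happ (σ : Perm (Fin n)) (i j : Fin n) :
      σ.permMatrix ℝ i j = if σ i = j then 1 else 0 := by
    simp [Equiv.Perm.permMatrix, PEquiv.toMatrix_apply]
  have hmem : N ∈ doublyStochastic ℝ (Fin n) := by
    rw [mem_doublyStochastic_iff_sum]
    refine ⟨fun i j => ?_, fun i => ?_, fun j => ?_⟩
    · rw [hN, Matrix.smul_apply, smul_eq_mul]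
      refine mul_nonneg (inv_nonneg.2 hn'.le) ?_
      rw [Matrix.sub_apply, Matrix.sum_apply, sub_nonneg]
      refine le_trans (le_of_eq ?_) (Finset.single_le_sum
        (f := fun k => (τ k).permMatrix ℝ i j) (fun k _ => ?_) (Finset.mem_univ i))
      · simp only [happ, hτ]
      · rw [happ]; split_ifs <;> norm_num
    · simp only [hN, Matrix.smul_apply, Matrix.sub_apply, Matrix.sum_apply, smul_eq_mul,
        ← Finset.mul_sum, Finset.sum_sub_distrib]
      rw [Finset.sum_comm]
      simp [hn'.ne']
    · simp only [hN, Matrix.smul_apply, Matrix.sub_apply, Matrix.sum_apply, smul_eq_mul,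
        ← Finset.mul_sum, Finset.sum_sub_distrib]
      rw [Finset.sum_comm]
      simp [← Perm.eq_inv_iff_eq, hn'.ne']
  obtain ⟨w, hw0, -, hw⟩ := exists_eq_sum_perm_of_mem_doublyStochastic hmem
  have h1 : 0 ≤ F N := by
    rw [← hw, map_sum]
    refine Finset.sum_nonneg fun σ _ => ?_
    rw [map_smul, hF, smul_eq_mul]
    exact mul_nonneg (hw0 σ) (by split_ifs <;> norm_num)
  -- `F` is 0 at every τ_k and 1 at π, hence negative at `N`. Yet by Birkhoff `N` is a convex
  -- combination of permutation matrices, where `F` is nonnegative.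
  have h2 : F N = -(n - 1 : ℝ)⁻¹ := by
    rw [hN, map_smul, map_sub, map_sum, hF, if_pos hπ, Finset.sum_eq_zero fun k _ => by
      rw [hF, if_neg (hτD k)]]
    simp
  have h3 := inv_pos.2 hn'
  linarith

end Span

/-! ### Matrix forms -/

section MatrixForm

variable {n d : ℕ} {p : n.Partition}

/-- The extension of a matrix representation to the group algebra. -/
def repMatrix (ρ : Perm (Fin n) →* Matrix.orthogonalGroup (Fin d) ℝ) (b : SymAlgebra n) :
    Matrix (Fin d) (Fin d) ℝ := ∑ g, b.coeff g • (ρ g : Matrix (Fin d) (Fin d) ℝ)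

lemma repMatrix_apply (ρ : Perm (Fin n) →* Matrix.orthogonalGroup (Fin d) ℝ) (b : SymAlgebra n)
    (ij : Fin d × Fin d) : repMatrix ρ b ij.1 ij.2 = ∑ g, b.coeff g * matrixEntries ρ ij g := by
  simp [repMatrix, Matrix.sum_apply, matrixEntries]

lemma repMatrix_indicatorSum_apply (ρ : Perm (Fin n) →* Matrix.orthogonalGroup (Fin d) ℝ)
    (D : Finset (Perm (Fin n))) (ij : Fin d × Fin d) :
    repMatrix ρ (indicatorSum D) ij.1 ij.2 = ∑ g ∈ D, matrixEntries ρ ij g := by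
  simp [repMatrix_apply, coeff_indicatorSum]

variable {ρ : Perm (Fin n) →* Matrix.orthogonalGroup (Fin d) ℝ} {T : Tableau p}
  {e : spechtModule T ≃ₗ[ℝ] (Fin d → ℝ)}
  (he : ∀ (σ : Perm (Fin n)) (x : spechtModule T),
    e (MonoidAlgebra.single σ (1 : ℝ) • x) =
      Matrix.mulVec (ρ σ : Matrix (Fin d) (Fin d) ℝ) (e x))

include he

lemma map_smul_eq_repMatrix_mulVec (b : SymAlgebra n) (x : spechtModule T) :
    e (b • x) = Matrix.mulVec (repMatrix ρ b) (e x) := by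
  have h : b • x = ∑ g, b.coeff g • (MonoidAlgebra.single g (1 : ℝ) • x) := by
    conv_lhs => rw [eq_sum_smul_single b, Finset.sum_smul]
    exact Finset.sum_congr rfl fun g _ => smul_assoc _ _ _
  rw [h, map_sum, repMatrix, Matrix.sum_mulVec]
  simp only [map_smul, he, Matrix.smul_mulVec]

lemma repMatrix_eq_smul_one {b : SymAlgebra n} {s : ℝ}
    (hb : ∀ x, b * x * youngSymmetrizer T = s • (x * youngSymmetrizer T)) :
    repMatrix ρ b = s • 1 := by
  refine Matrix.toLin'.injective (LinearMap.ext fun v => ?_)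
  obtain ⟨x, rfl⟩ := e.surjective v
  obtain ⟨y, hy⟩ := Ideal.mem_span_singleton'.1 x.2
  rw [Matrix.toLin'_apply, Matrix.toLin'_apply, ← map_smul_eq_repMatrix_mulVec he,
    Matrix.smul_mulVec, Matrix.one_mulVec, ← map_smul]
  congr 1
  refine Subtype.ext ?_
  have h := hb y
  rw [mul_assoc, hy] at h
  exact h

lemma repMatrix_eq_zero_iff {b : SymAlgebra n} :
    repMatrix ρ b = 0 ↔ Kills b (youngSymmetrizer T) := by
  refine ⟨fun h x => ?_, fun h => ?_⟩
  · have hx : x * youngSymmetrizer T ∈ spechtModule T := Ideal.mem_span_singleton'.2 ⟨x, rfl⟩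
    have h1 := map_smul_eq_repMatrix_mulVec he b ⟨_, hx⟩
    rw [h, Matrix.zero_mulVec] at h1
    have h2 := congrArg Subtype.val (e.map_eq_zero_iff.1 h1)
    rw [mul_assoc]
    exact h2
  · rw [repMatrix_eq_smul_one he (s := 0) fun x => by rw [h x, zero_smul], zero_smul]

/-- No matrix entry of a Specht module vanishes identically. -/
lemma matrixEntries_ne_zero (ij : Fin d × Fin d) : matrixEntries ρ ij ≠ 0 := fun h0 => by
  obtain ⟨i, j⟩ := ij
  set w := e.symm (Pi.single j 1) with hw
  have hwe (b : SymAlgebra n) : e (b • w) i = 0 := by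
    rw [map_smul_eq_repMatrix_mulVec he, hw, LinearEquiv.apply_symm_apply,
      Matrix.mulVec_single_one, Matrix.col_apply]
    exact (repMatrix_apply ρ b (i, j)).trans (by simp [h0])
  have hw0 : (w : SymAlgebra n) ≠ 0 := fun h => by
    have h1 : w = 0 := Subtype.ext h
    have h2 := congrFun (e.symm.map_eq_zero_iff.1 h1) j
    simp at h2
  obtain ⟨y, hy⟩ := Ideal.mem_span_singleton'.1 w.2
  -- The value c x w is s c. If s ≠ 0, then w generates the whole module, including the i-th basis
  -- vector, whose i-th coordinate is not 0.
  have hcw (x : SymAlgebra n) : youngSymmetrizer T * x * w = 0 := by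
    obtain ⟨s, hs⟩ := exists_youngSymmetrizer_mul_mul T (x * y)
    have hs' : youngSymmetrizer T * x * w = s • youngSymmetrizer T := by
      rw [← hs, ← hy]
      simp only [mul_assoc]
    rcases eq_or_ne s 0 with rfl | hs0
    · rw [hs', zero_smul]
    · exfalso
      obtain ⟨z, hz⟩ := Ideal.mem_span_singleton'.1 (e.symm (Pi.single i 1)).2
      have h1 : e.symm (Pi.single i 1) = (s⁻¹ • z * (youngSymmetrizer T * x)) • w := by
        refine Subtype.ext ?_
        rw [← hz]
        change _ = s⁻¹ • z * (youngSymmetrizer T * x) * (w : SymAlgebra n)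
        rw [mul_assoc, hs', smul_mul_assoc, mul_smul_comm, smul_smul, inv_mul_cancel₀ hs0,
          one_smul]
      have h2 := hwe (s⁻¹ • z * (youngSymmetrizer T * x))
      rw [← h1, LinearEquiv.apply_symm_apply] at h2
      simp at h2
  refine adj_mul_self_ne_zero (adj_mul_self_ne_zero hw0) ?_
  -- Writing w = y c turns w w* w into y (c w* w), which is 0; positivity forbids this for w ≠ 0.
  have h3 : (w : SymAlgebra n) * adj (w : SymAlgebra n) * w = 0 := by
    nth_rewrite 1 [← hy]
    rw [mul_assoc, mul_assoc, ← mul_assoc (youngSymmetrizer T), hcw, mul_zero]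
  rw [adj_mul, adj_adj, mul_assoc, ← mul_assoc (w : SymAlgebra n), h3, mul_zero]

end MatrixForm

/-! ### Laplacian eigenvectors -/

section Eigenvector

variable {n d : ℕ}

lemma indicatorSum_mem_center {X : Finset (Perm (Fin n))}
    (hX : ∀ x ∈ X, ∀ g, g * x * g⁻¹ ∈ X) :
    indicatorSum X ∈ Subalgebra.center ℝ (SymAlgebra n) := by
  refine mem_center_of_comm_single fun g => ?_
  ext σ
  rw [MonoidAlgebra.coeff_single_mul_apply, MonoidAlgebra.coeff_mul_single_apply,
    coeff_indicatorSum, coeff_indicatorSum, one_mul, mul_one]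
  refine if_congr ⟨fun h => ?_, fun h => ?_⟩ rfl rfl
  · simpa [mul_assoc] using hX _ h g
  · simpa [mul_assoc] using hX _ h g⁻¹

lemma isLaplacianEigenvector_matrixEntries {X : Set (Perm (Fin n))} (hX : IsNormalConnectionSet X)
    {ρ : Perm (Fin n) →* Matrix.orthogonalGroup (Fin d) ℝ} {s : ℝ}
    (hs : open Classical in repMatrix ρ (indicatorSum X.toFinset) = s • 1) {ij : Fin d × Fin d}
    (h0 : matrixEntries ρ ij ≠ 0) :
    IsLaplacianEigenvector (SimpleGraph.mulCayley X) (matrixEntries ρ ij) := by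
  classical
  have hs' : repMatrix ρ (indicatorSum X.toFinset) = s • 1 := by convert hs
  have hnb (v : Perm (Fin n)) [Fintype ((SimpleGraph.mulCayley X).neighborSet v)] :
      (SimpleGraph.mulCayley X).neighborFinset v =
      X.toFinset.map (Equiv.mulLeft v).toEmbedding := by
    ext u
    rw [SimpleGraph.mem_neighborFinset, SimpleGraph.mulCayley_adj']
    simp only [Finset.mem_map_equiv, Set.mem_toFinset, Equiv.mulLeft_symm_apply]
    constructor
    · rintro ⟨-, g, hg, rfl | rfl⟩
      · simpa using hg
      · simpa using hX.2.1 g hg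
    · intro h
      refine ⟨?_, v⁻¹ * u, h, Or.inl (by simp)⟩
      rintro rfl
      exact hX.1 (by simpa using h)
  -- The eigenvalue is the degree minus s: the neighbours of v are the v x, and summing ρ(v x) over
  -- x in X gives s ρ(v).
  refine ⟨X.toFinset.card - s, ?_, h0⟩
  rw [Module.End.mem_eigenspace_iff]
  ext v
  change Matrix.mulVec _ _ _ = _
  rw [SimpleGraph.lapMatrix_mulVec_apply, ← SimpleGraph.card_neighborFinset_eq_degree, hnb,
    Finset.card_map, Finset.sum_map, Pi.smul_apply, smul_eq_mul, sub_mul]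
  congr 1
  have h1 : ∑ x ∈ X.toFinset, matrixEntries ρ ij (v * x) =
      ((ρ v : Matrix (Fin d) (Fin d) ℝ) * repMatrix ρ (indicatorSum X.toFinset)) ij.1 ij.2 := by
    rw [Matrix.mul_apply]
    simp only [fun k => repMatrix_indicatorSum_apply ρ X.toFinset (k, ij.2), Finset.mul_sum]
    rw [Finset.sum_comm]
    refine Finset.sum_congr rfl fun x _ => ?_
    simp [matrixEntries, map_mul, Matrix.mul_apply]
  simp only [Equiv.coe_toEmbedding, Equiv.coe_mulLeft]
  rw [h1, hs', mul_smul_comm, mul_one]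
  rfl

end Eigenvector

/-! ### Cosets of the point stabilizer -/

section Coset

variable {n : ℕ}

lemma mem_symSubgroup_iff (hn : 2 ≤ n) {π : Perm (Fin n)} :
    π ∈ symSubgroup n (n - 1) ↔ π ⟨n - 1, by omega⟩ = ⟨n - 1, by omega⟩ := by
  rw [symSubgroup, mem_fixingSubgroup_iff]
  refine ⟨fun h => h _ (le_refl (n - 1)), fun h y hy => ?_⟩
  have hy' : y = ⟨n - 1, by omega⟩ := Fin.ext (by
    have h1 : n - 1 ≤ (y : ℕ) := hy
    have h2 := y.2
    simp only
    omega)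
  rw [hy']
  exact h

lemma isCosetOf_symSubgroup_iff (hn : 2 ≤ n) {D : Finset (Perm (Fin n))} :
    IsCosetOf (symSubgroup n (n - 1)) D ↔ ∃ i j, D = pointCoset i j := by
  -- The last point has index n - 1; σ s τ sends its preimage under τ to its image under σ.
  have key (σ τ : Perm (Fin n)) :
      (fun s => σ * s * τ) '' (symSubgroup n (n - 1) : Set (Perm (Fin n))) =
        pointCoset (τ⁻¹ ⟨n - 1, by omega⟩) (σ ⟨n - 1, by omega⟩) := by
    ext π
    simp only [Set.mem_image, SetLike.mem_coe, mem_symSubgroup_iff hn, mem_pointCoset]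
    constructor
    · rintro ⟨s, hs, rfl⟩
      simp [hs]
    · intro h
      exact ⟨σ⁻¹ * π * τ⁻¹, by
        rw [Perm.mul_apply, Perm.mul_apply, h, ← Perm.mul_apply, inv_mul_cancel, Perm.one_apply], by group⟩
  constructor
  · rintro ⟨σ, τ, h⟩
    exact ⟨_, _, Finset.coe_injective (h.trans (key σ τ))⟩
  · rintro ⟨i, j, rfl⟩
    refine ⟨swap ⟨n - 1, by omega⟩ j, swap ⟨n - 1, by omega⟩ i, ?_⟩
    rw [key, swap_inv, swap_apply_left, swap_apply_left]

lemma card_pointCoset_eq (i j i' j' : Fin n) :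
    (pointCoset i j).card = (pointCoset i' j').card := by
  refine Finset.card_equiv ((Equiv.mulLeft (swap j j')).trans (Equiv.mulRight (swap i i'))) ?_
  intro π
  simp [swap_apply_eq_iff]

end Coset

/-! ### Designs and linear relations with permutation matrices -/

section Design

variable {n : ℕ} {d : n.Partition → ℕ}
  {ρ : ∀ p : n.Partition, Perm (Fin n) →* Matrix.orthogonalGroup (Fin (d p)) ℝ}
  {T : ∀ p : n.Partition, Tableau p} {e : ∀ p, spechtModule (T p) ≃ₗ[ℝ] (Fin (d p) → ℝ)}
  (he : ∀ p (σ : Perm (Fin n)) (x : spechtModule (T p)),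
    e p (MonoidAlgebra.single σ (1 : ℝ) • x) =
      Matrix.mulVec (ρ p σ : Matrix (Fin (d p)) (Fin (d p)) ℝ) (e p x))

include he

lemma isDesign_iff (hn : 2 ≤ n) {D : Finset (Perm (Fin n))} :
    IsDesign (entriesBelow ρ (n - 1)) D ↔ D.Nonempty ∧
      ∀ p : n.Partition, firstPart p < n - 1 →
        Kills (indicatorSum D) (youngSymmetrizer (T p)) := by
  refine and_congr_right fun hD => ?_
  -- The group is the disjoint union of the sets {π | π 0 = j}, each annihilating the module.
  -- Averaging thus means that the sum over D vanishes.
  have huniv {p : n.Partition} (hp : firstPart p < n - 1) (ij : Fin (d p) × Fin (d p)) :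
      ∑ π, matrixEntries (ρ p) ij π = 0 := by
    have h : indicatorSum (Finset.univ : Finset (Perm (Fin n))) =
        ∑ j, indicatorSum (pointCoset ⟨0, by omega⟩ j) := by
      ext σ
      simp [coeff_indicatorSum, MonoidAlgebra.coeff_sum]
    have hk : Kills (indicatorSum (Finset.univ : Finset (Perm (Fin n))))
        (youngSymmetrizer (T p)) := fun x => by
      rw [h, Finset.sum_mul, Finset.sum_mul]
      exact Finset.sum_eq_zero fun j _ => kills_pointCoset hp (T p) _ j x
    rw [← repMatrix_indicatorSum_apply, (repMatrix_eq_zero_iff (he p)).2 hk, Matrix.zero_apply]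
  have hcard : (1 / (D.card : ℝ)) ≠ 0 := by
    have := hD.card_pos
    positivity
  constructor
  · intro h p hp
    rw [← repMatrix_eq_zero_iff (he p)]
    ext i j
    have h1 := h _ (Set.mem_iUnion₂.2 ⟨p, hp, ⟨(i, j), rfl⟩⟩)
    rw [Averages, huniv hp, mul_zero] at h1
    rw [Matrix.zero_apply]
    exact (repMatrix_indicatorSum_apply (ρ p) D (i, j)).trans
      ((mul_eq_zero.1 h1).resolve_left hcard)
  · intro h φ hφ
    obtain ⟨p, hp, ij, rfl⟩ := Set.mem_iUnion₂.1 hφ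
    rw [Averages, huniv hp, ← repMatrix_indicatorSum_apply,
      (repMatrix_eq_zero_iff (he p)).2 (h p hp), Matrix.zero_apply, mul_zero, mul_zero]

lemma isDesign_pointCoset (hn : 2 ≤ n) (i j : Fin n) :
    IsDesign (entriesBelow ρ (n - 1)) (pointCoset i j) :=
  (isDesign_iff he hn).2 ⟨⟨swap i j, by simp⟩, fun p hp => kills_pointCoset hp (T p) i j⟩

lemma IsDesign.exists_pointCoset_subset (hn : 2 ≤ n) {D : Finset (Perm (Fin n))}
    (hD : IsDesign (entriesBelow ρ (n - 1)) D) {π : Perm (Fin n)} (hπ : π ∈ D) :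
    ∃ i, pointCoset i (π i) ⊆ D := by
  have hk := ((isDesign_iff he hn).1 hD).2
  obtain ⟨a, ha⟩ := exists_eq_sum_apply (φ := (indicatorSum D).coeff) fun b hb =>
    sum_coeff_mul_coeff_eq_zero T fun p => (lt_or_ge (firstPart p) (n - 1)).imp (hk p)
      fun hp => hb.kills hn hp (T p)
  simp only [coeff_indicatorSum] at ha
  obtain ⟨i, hi⟩ := exists_forall_apply_eq_mem hn ha hπ
  exact ⟨i, fun σ hσ => hi σ (mem_pointCoset.1 hσ)⟩

/-- Every design contains a point coset, and point cosets all have the same size. -/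
lemma minimal_isDesign_iff (hn : 2 ≤ n) {D : Finset (Perm (Fin n))} :
    Minimal (IsDesign (entriesBelow ρ (n - 1))) D ↔ ∃ i j, D = pointCoset i j := by
  constructor
  · intro h
    obtain ⟨π, hπ⟩ := h.prop.1
    obtain ⟨i, hi⟩ := IsDesign.exists_pointCoset_subset he hn h.prop hπ
    exact ⟨i, π i, (h.le_of_le (isDesign_pointCoset he hn i (π i)) hi).antisymm hi⟩
  · rintro ⟨i, j, rfl⟩
    refine ⟨isDesign_pointCoset he hn i j, fun D' hD' hle => ?_⟩
    obtain ⟨π, hπ⟩ := hD'.1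
    obtain ⟨i', hi'⟩ := IsDesign.exists_pointCoset_subset he hn hD' hπ
    have h1 := Finset.eq_of_subset_of_card_le (hi'.trans hle) (card_pointCoset_eq _ _ _ _).le
    exact h1 ▸ hi'

/-- If the first part of `p` is at least `n - 1`, the matrix entries of the representation indexed
by `p` are linear functions of the permutation matrix. -/
lemma exists_matrixEntries_eq_sum (hn : 2 ≤ n) {p : n.Partition} (hp : n - 1 ≤ firstPart p)
    (kl : Fin (d p) × Fin (d p)) :
    ∃ a : Fin n → Fin n → ℝ, ∀ π, matrixEntries (ρ p) kl π = ∑ i, a i (π i) := by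
  refine exists_eq_sum_apply fun b hb => ?_
  have h := repMatrix_apply (ρ p) b kl
  rw [(repMatrix_eq_zero_iff (he p)).2 (hb.kills hn hp (T p)), Matrix.zero_apply] at h
  simpa only [mul_comm] using h.symm

lemma perp_of_repMatrix_eq_zero (hn : 2 ≤ n) {b : SymAlgebra n} (hb1 : ∑ π, b.coeff π = 0)
    (hb : repMatrix (ρ (standardPartition n hn)) b = 0) : Perp b := fun i j => by
  have h := sum_coeff_mul_coeff_eq_zero T (f := indicatorSum (pointCoset i j)) (b := b) fun p => by
    rcases lt_or_ge (firstPart p) (n - 1) with hp | hp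
    · exact Or.inl (kills_pointCoset hp (T p) i j)
    refine Or.inr ?_
    rcases firstPart_eq_or_eq_standardPartition hn hp with hp | rfl
    · exact kills_of_sum_coeff_eq_zero hb1 hp (T p)
    · exact (repMatrix_eq_zero_iff (he _)).1 hb
  simpa only [coeff_indicatorSum, ite_mul, one_mul, zero_mul, Finset.sum_ite_mem,
    Finset.univ_inter] using h

end Design


/-- The eigenpolytope of a representation of type `(n - 1, 1)` is the Birkhoff polytope. -/
theorem exists_affineMap_eigenpolytope {n d : ℕ} {φ : Fin d × Fin d → Perm (Fin n) → ℝ}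
    (hφ : ∀ kl, ∃ a : Fin n → Fin n → ℝ, ∀ π, φ kl π = ∑ i, a i (π i))
    (hperp : ∀ b : SymAlgebra n, ∑ π, b.coeff π = 0 → (∀ kl, ∑ π, φ kl π * b.coeff π = 0) →
      Perp b) :
    ∃ f : (Fin d × Fin d → ℝ) →ᵃ[ℝ] Matrix (Fin n) (Fin n) ℝ,
      Set.BijOn f (eigenpolytope φ) (birkhoffPolytope n) ∧
      ∀ π : Perm (Fin n), f (eigenColumn φ π) = π.permMatrix ℝ := by
  choose a ha using hφ
  -- The index `none` carries the constant function, accounting for the trivial representation; its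
  -- coefficient becomes the translation part of `f`.
  have hinv (i j : Fin n) : ∃ α : Option (Fin d × Fin d) → ℝ, ∀ π : Perm (Fin n),
      (if π i = j then (1 : ℝ) else 0) = ∑ k, α k * k.elim 1 (fun kl => φ kl π) := by
    refine exists_eq_sum_of_forall_perp
      (fun (k : Option (Fin d × Fin d)) π => k.elim 1 fun kl => φ kl π) _ fun b hb => ?_
    rw [sum_ite_mul_eq]
    simpa using hperp (ofFun b) (by simpa using hb none) (fun kl => by simpa using hb (some kl)) i j
  choose α hα using hinv
  let L : (Fin d × Fin d → ℝ) →ₗ[ℝ] Matrix (Fin n) (Fin n) ℝ :=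
    { toFun := fun M => Matrix.of fun i j => ∑ kl, α i j (some kl) * M kl
      map_add' := fun M N => by ext; simp [mul_add, Finset.sum_add_distrib]
      map_smul' := fun r M => by ext; simp [Finset.mul_sum, mul_left_comm] }
  let f : (Fin d × Fin d → ℝ) →ᵃ[ℝ] Matrix (Fin n) (Fin n) ℝ :=
    L.toAffineMap + AffineMap.const ℝ _ (Matrix.of fun i j => α i j none)
  let g : Matrix (Fin n) (Fin n) ℝ →ₗ[ℝ] (Fin d × Fin d → ℝ) :=
    { toFun := fun N kl => ∑ i, ∑ j, a kl i j * N i j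
      map_add' := fun M N => by ext; simp [mul_add, Finset.sum_add_distrib]
      map_smul' := fun r M => by ext; simp [Finset.mul_sum, mul_left_comm] }
  have hf (π : Perm (Fin n)) : f (eigenColumn φ π) = π.permMatrix ℝ := by
    ext i j
    have h := hα i j π
    simp only [Fintype.sum_option, Option.elim, mul_one] at h
    have h1 : f (eigenColumn φ π) i j = ∑ kl, α i j (some kl) * φ kl π + α i j none := rfl
    rw [h1, add_comm, ← h]
    simp [Equiv.Perm.permMatrix, PEquiv.toMatrix_apply]
  have hg (π : Perm (Fin n)) : g (π.permMatrix ℝ) = eigenColumn φ π := by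
    ext kl
    simp [g, eigenColumn, ha, Equiv.Perm.permMatrix, PEquiv.toMatrix_apply]
  have himage : f '' eigenpolytope φ = birkhoffPolytope n := by
    rw [eigenpolytope, AffineMap.image_convexHull, ← Set.range_comp, birkhoffPolytope]
    congr 2
    exact funext hf
  -- The points fixed by g ∘ f form a convex set containing the vertices.
  have hinj : ∀ x ∈ eigenpolytope φ, g (f x) = x := by
    have hconv : Convex ℝ {x | g (f x) = x} := fun x hx y hy s t _ _ hst => by
      have h1 : f (s • x + t • y) = s • f x + t • f y := Convex.combo_affine_apply hst
      rw [Set.mem_ofPred_eq, h1, map_add, map_smul, map_smul, hx, hy]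
    refine fun x hx => convexHull_min ?_ hconv hx
    rintro _ ⟨π, rfl⟩
    rw [Set.mem_ofPred_eq, hf, hg]
  exact ⟨f, himage ▸ (Set.InjOn.bijOn_image fun x hx y hy hxy => by
    rw [← hinj x hx, hxy, hinj y hy]), hf⟩

end

theorem mainTheorem11 (n : ℕ) (hn : 2 ≤ n)
    (d : n.Partition → ℕ)
    (ρ : ∀ p : n.Partition, Equiv.Perm (Fin n) →* Matrix.orthogonalGroup (Fin (d p)) ℝ)
    (hρ : ∀ p : n.Partition, IsOrthogonalForm p (ρ p))
    (X : Set (Equiv.Perm (Fin n))) (hX : IsNormalConnectionSet X) :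
    -- the functions in all the `Φ_p` are Laplacian eigenvectors of the normal Cayley graph
    (∀ (p : n.Partition) (ij : Fin (d p) × Fin (d p)),
      IsLaplacianEigenvector (SimpleGraph.mulCayley X) (matrixEntries (ρ p) ij)) ∧
    -- the `Φ_{(n-1,1)}`-eigenpolytope is affinely isomorphic to the Birkhoff polytope
    (∃ f : (Fin (d (standardPartition n hn)) × Fin (d (standardPartition n hn)) → ℝ) →ᵃ[ℝ]
          Matrix (Fin n) (Fin n) ℝ,
      Set.BijOn f (eigenpolytope (matrixEntries (ρ (standardPartition n hn))))
        (birkhoffPolytope n) ∧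
      ∀ π : Equiv.Perm (Fin n),
        f (eigenColumn (matrixEntries (ρ (standardPartition n hn))) π) = π.permMatrix ℝ) ∧
    -- the minimal designs are exactly the cosets of `S_{n-1}`
    (∀ D : Finset (Equiv.Perm (Fin n)),
      Minimal (IsDesign (entriesBelow ρ (n - 1))) D ↔ IsCosetOf (symSubgroup n (n - 1)) D) ∧
    -- these cosets are the sets `{π | π i = j}`
    (∀ D : Finset (Equiv.Perm (Fin n)),
      IsCosetOf (symSubgroup n (n - 1)) D ↔
        ∃ i j : Fin n, (D : Set (Equiv.Perm (Fin n))) = {π | π i = j}) ∧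
    -- every design is a union of such cosets
    (∀ D : Finset (Equiv.Perm (Fin n)), IsDesign (entriesBelow ρ (n - 1)) D →
      ∃ 𝒞 : Set (Finset (Equiv.Perm (Fin n))),
        (∀ C ∈ 𝒞, IsCosetOf (symSubgroup n (n - 1)) C) ∧
        (D : Set (Equiv.Perm (Fin n))) = ⋃ C ∈ 𝒞, (C : Set (Equiv.Perm (Fin n)))) := by
  classical
  choose T e he using hρ
  refine ⟨fun p ij => ?_, ?_, fun D => ?_, fun D => ?_, fun D hD => ?_⟩
  · obtain ⟨s, hs⟩ := exists_center_mul_youngSymmetrizer T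
      (indicatorSum_mem_center (X := X.toFinset) (by simpa using hX.2.2)) p
    refine isLaplacianEigenvector_matrixEntries (s := s) hX ?_ (matrixEntries_ne_zero (he p) ij)
    convert repMatrix_eq_smul_one (he p) hs
  · have hstd : n - 1 ≤ firstPart (standardPartition n hn) :=
      Multiset.le_sup (by simp [standardPartition])
    refine exists_affineMap_eigenpolytope
      (fun kl => exists_matrixEntries_eq_sum he hn hstd kl) fun b hb1 hb =>
        perp_of_repMatrix_eq_zero he hn hb1 ?_
    ext k l
    refine (repMatrix_apply _ b (k, l)).trans ?_
    simpa only [mul_comm, Matrix.zero_apply] using hb (k, l)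
  · rw [minimal_isDesign_iff he hn, isCosetOf_symSubgroup_iff hn]
  · rw [isCosetOf_symSubgroup_iff hn]
    refine exists_congr fun i => exists_congr fun j => ?_
    rw [← Finset.coe_inj]
    simp [pointCoset]
  · refine ⟨{C | IsCosetOf (symSubgroup n (n - 1)) C ∧ C ⊆ D}, fun C hC => hC.1, ?_⟩
    refine Set.Subset.antisymm (fun π hπ => ?_) (Set.iUnion₂_subset fun C hC => hC.2)
    obtain ⟨i, hi⟩ := IsDesign.exists_pointCoset_subset he hn hD hπ
    exact Set.mem_biUnion (x := pointCoset i (π i))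
      ⟨(isCosetOf_symSubgroup_iff hn).2 ⟨i, π i, rfl⟩, hi⟩ (by simp)
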